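/- **Definitions.** A graph here is a connected, locally finite multigraph (loops and multiple edges allowed). Let $\Xi$ be a one-point set (unmarked graphs) or $\{0,1\}$. Let $\mathcal G_*(\Xi)$ (resp. $\mathcal G_{**}(\Xi)$) be the set of isomorphism classes $[G,o]$ (resp. $[G,o,v]$) of graphs $G$ whose vertices carry marks in $\Xi$, together with a root $o$ (resp. an ordered pair $(o,v)$ of vertices); isomorphisms preserve marks and roots. Both spaces carry the topology of local convergence, generated by the sets of all classes whose ball of radius $r$ around the (first) root $o$ is isomorphic to that of a given rooted (resp. doubly rooted) marked graph (by an isomorphism that preserves the marks and the first root and, for $\mathcal G_{**}$, also respects the second root), and the corresponding Borel $\sigma$-field. A probability measure $\mu$ on $\mathcal G_*(\Xi)$ is *unimodular* if for every measurable $g:\mathcal G_{**}(\Xi)\to\mathbb R^{\ge 0}$ $$\int \sum_{v\in V(G)} g[G,o,v]\, d\mu([G,o]) = \int \sum_{v\in V(G)} g[G,v,o]\, d\mu([G,o]) \in [0,\infty].$$ Given probability measures $\nu,\nu'$ on $\mathcal G_*(\Xi)$ and a measurable $T:\mathcal G_{**}(\Xi)\to\mathbb R^{\ge 0}$, we say that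 $\nu'$ is the *root-change of $\nu$ by the kernel $T$* if $\sum_{v\in V(G)}T[G,o,v]=1$ for $\nu$-almost every $[G,o]$, and for every measurable $A\subseteq \mathcal G_*(\Xi)$ $$\nu'(A)=\int \sum_{v\in V(G)} T[G,o,v]\,\mathbf 1_A[G,v]\, d\nu([G,o]).$$ **Proposition (Extra Head Scheme).** Let $\mu$ be a unimodular probability measure on the space of rooted unmarked graphs such that $G$ is infinite for $\mu$-almost every $[G,o]$, and let $0<p\le 1$. Let $\nu$ be the distribution of the random rooted graph with marks in $\{0,1\}$ obtained from a random rooted graph $[\boldsymbol G,\boldsymbol o]$ with distribution $\mu$ by giving its vertices, conditionally on $[\boldsymbol G,\boldsymbol o]$, i.i.d. Bernoulli$(p)$ marks. Let $\nu'$ be the image of $\nu$ under the map that changes the mark of the root to $1$ and leaves everything else unchanged. Then there exists a measurable $T:\mathcal G_{**}(\{0,1\})\to\mathbb R^{\ge 0}$ such that $\nu'$ is the root-change of $\nu$ by the kernel $T$. -/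

import Mathlib

open MeasureTheory ProbabilityTheory
open scoped ENNReal NNReal

/-- A connected, locally finite network: a multigraph (loops and multiple edges allowed) on the
vertex set `V`, given by the number `mult u v` of edges joining `u` and `v`, with a mark in `Ξ` on
every vertex. Edges carry no marks. As such a network has countably many vertices, taking `V` in
`Type` loses nothing up to isomorphism. The mark space `Ξ` is regarded as a discrete space; below
it is a one-point space (unmarked graphs) or `Bool` (marks in `{0, 1}`). -/
structure Network (Ξ : Type) where
  V : Type
  mult : V → V → ℕ
  mult_symm : ∀ u v, mult u v = mult v u
  locallyFinite : ∀ v, {w | mult v w ≠ 0}.Finite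
  connected : ∀ u v, Relation.ReflTransGen (fun a b => mult a b ≠ 0) u v
  mark : V → Ξ

/-- A network with a distinguished vertex. -/
structure RootedNetwork (Ξ : Type) extends Network Ξ where
  root : V

/-- A network with an ordered pair of distinguished vertices. -/
structure DoublyRootedNetwork (Ξ : Type) extends RootedNetwork Ξ where
  root₂ : V

namespace Network

variable {Ξ : Type}

/-- The simple graph of adjacency between distinct vertices. -/
def graph (N : Network Ξ) : SimpleGraph N.V where
  Adj u v := u ≠ v ∧ N.mult u v ≠ 0
  symm := ⟨fun u v h => ⟨h.1.symm, by rw [N.mult_symm]; exact h.2⟩⟩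
  loopless := ⟨fun _ h => h.1 rfl⟩

/-- The graph distance. -/
noncomputable def dist (N : Network Ξ) (u v : N.V) : ℕ := N.graph.dist u v

/-- The closed ball of radius `r` around `o`. -/
def ball (N : Network Ξ) (o : N.V) (r : ℕ) : Set N.V := {v | N.dist o v ≤ r}

theorem preconnected (N : Network Ξ) : N.graph.Preconnected := by
  intro u v
  induction N.connected u v with
  | refl => exact SimpleGraph.Reachable.refl _
  | @tail b c _ h ih =>
    by_cases hbc : b = c
    · exact hbc ▸ ih
    · exact ih.trans (SimpleGraph.Adj.reachable (⟨hbc, h⟩ : N.graph.Adj b c))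

theorem root_mem_ball (N : Network Ξ) (o : N.V) (r : ℕ) : o ∈ N.ball o r := by
  simp [ball, dist]

theorem ball_mono (N : Network Ξ) (o : N.V) {r s : ℕ} (h : r ≤ s) : N.ball o r ⊆ N.ball o s :=
  fun _ hv => le_trans (show N.dist o _ ≤ r from hv) h

theorem exists_pred (N : Network Ξ) {o v : N.V} {k : ℕ} (h : N.dist o v = k + 1) :
    ∃ w, N.dist o w = k ∧ N.mult v w ≠ 0 := by
  obtain ⟨p, hp⟩ := (N.preconnected v o).exists_walk_length_eq_dist
  cases p with
  | nil =>
    simp only [dist, SimpleGraph.dist_self] at h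
    omega
  | @cons _ w _ hadj q =>
    refine ⟨w, ?_, hadj.2⟩
    have h1 : N.graph.dist w o ≤ q.length := SimpleGraph.dist_le q
    have h2 : N.graph.dist v o = k + 1 := by rw [SimpleGraph.dist_comm]; exact h
    have h3 : N.graph.dist v o ≤ N.graph.dist w o + 1 := by
      obtain ⟨q', hq'⟩ := (N.preconnected w o).exists_walk_length_eq_dist
      have := SimpleGraph.dist_le (SimpleGraph.Walk.cons hadj q')
      rwa [SimpleGraph.Walk.length_cons, hq'] at this
    rw [SimpleGraph.Walk.length_cons] at hp
    change N.graph.dist o w = k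
    rw [SimpleGraph.dist_comm]
    omega

theorem dist_le_succ (N : Network Ξ) (o : N.V) {v w : N.V} (h : N.mult v w ≠ 0) :
    N.dist o v ≤ N.dist o w + 1 := by
  by_cases hvw : v = w
  · subst hvw; omega
  · obtain ⟨q', hq'⟩ := (N.preconnected w o).exists_walk_length_eq_dist
    have := SimpleGraph.dist_le (SimpleGraph.Walk.cons (⟨hvw, h⟩ : N.graph.Adj v w) q')
    change N.graph.dist v o ≤ q'.length + 1 at this
    change N.graph.dist o v ≤ N.graph.dist o w + 1
    rwa [SimpleGraph.dist_comm, SimpleGraph.dist_comm (u := o), ← hq']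

theorem ball_finite (N : Network Ξ) (o : N.V) (r : ℕ) : (N.ball o r).Finite := by
  induction r with
  | zero =>
    refine (Set.finite_singleton o).subset fun v hv => ?_
    have h0 : N.graph.dist o v = 0 := Nat.le_zero.mp hv
    exact ((N.preconnected o v).dist_eq_zero_iff.mp h0).symm
  | succ r ih =>
    refine (ih.union (ih.biUnion fun w _ => N.locallyFinite w)).subset fun v hv => ?_
    rcases Nat.lt_or_ge (N.dist o v) (r + 1) with h | h
    · exact Or.inl (Nat.lt_succ_iff.mp h)
    · obtain ⟨w, hw, hvw⟩ := N.exists_pred (le_antisymm hv h)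
      refine Or.inr (Set.mem_biUnion (x := w) (show N.dist o w ≤ r from hw.le) ?_)
      change N.mult w v ≠ 0
      rwa [N.mult_symm]

instance (N : Network Ξ) (o : N.V) (r : ℕ) : Finite (N.ball o r) := N.ball_finite o r

theorem countable (N : Network Ξ) : Countable N.V := by
  rcases isEmpty_or_nonempty N.V with h | ⟨⟨o⟩⟩
  · infer_instance
  · rw [← Set.countable_univ_iff]
    have : (Set.univ : Set N.V) = ⋃ r : ℕ, N.ball o r := by
      ext v
      simp only [Set.mem_univ, Set.mem_iUnion, true_iff]
      exact ⟨N.dist o v, le_refl (N.dist o v)⟩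
    rw [this]
    exact Set.countable_iUnion fun r => (N.ball_finite o r).countable

end Network

namespace RootedNetwork

variable {Ξ : Type}

/-- Two rooted networks are isomorphic. -/
def Isom (M N : RootedNetwork Ξ) : Prop :=
  ∃ e : M.V ≃ N.V, (∀ u v, N.mult (e u) (e v) = M.mult u v) ∧ (∀ v, N.mark (e v) = M.mark v) ∧
    e M.root = N.root

/-- The balls of radius `r` around the roots are isomorphic as rooted networks. -/
def Agree (r : ℕ) (M N : RootedNetwork Ξ) : Prop :=
  ∃ e : M.ball M.root r ≃ N.ball N.root r,
    (∀ u v, N.mult (e u) (e v) = M.mult u v) ∧ (∀ v, N.mark (e v) = M.mark v) ∧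
    ∀ v : M.ball M.root r, (v : M.V) = M.root ↔ (e v : N.V) = N.root

instance setoid (Ξ : Type) : Setoid (RootedNetwork Ξ) where
  r := Isom
  iseqv :=
    { refl := fun M => ⟨Equiv.refl _, fun _ _ => rfl, fun _ => rfl, rfl⟩
      symm := by
        rintro M N ⟨e, h1, h2, h3⟩
        refine ⟨e.symm, fun u v => ?_, fun v => ?_, ?_⟩
        · rw [← h1, e.apply_symm_apply, e.apply_symm_apply]
        · rw [← h2, e.apply_symm_apply]
        · rw [← h3, e.symm_apply_apply]
      trans := by
        rintro M N P ⟨e, h1, h2, h3⟩ ⟨f, k1, k2, k3⟩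
        refine ⟨e.trans f, fun u v => ?_, fun v => ?_, ?_⟩
        · simp [k1, h1]
        · simp [k2, h2]
        · simp [h3, k3] }

/-- The same network with the second root `v`. -/
def withSecond (N : RootedNetwork Ξ) (v : N.V) : DoublyRootedNetwork Ξ := { N with root₂ := v }

end RootedNetwork

namespace DoublyRootedNetwork

variable {Ξ : Type}

/-- Two doubly rooted networks are isomorphic. -/
def Isom (M N : DoublyRootedNetwork Ξ) : Prop :=
  ∃ e : M.V ≃ N.V, (∀ u v, N.mult (e u) (e v) = M.mult u v) ∧ (∀ v, N.mark (e v) = M.mark v) ∧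
    e M.root = N.root ∧ e M.root₂ = N.root₂

/-- The balls of radius `r` around the first roots are isomorphic by a map that respects both
roots (the second one may lie outside of both balls). -/
def Agree (r : ℕ) (M N : DoublyRootedNetwork Ξ) : Prop :=
  ∃ e : M.ball M.root r ≃ N.ball N.root r,
    (∀ u v, N.mult (e u) (e v) = M.mult u v) ∧ (∀ v, N.mark (e v) = M.mark v) ∧
    (∀ v : M.ball M.root r, (v : M.V) = M.root ↔ (e v : N.V) = N.root) ∧
    ∀ v : M.ball M.root r, (v : M.V) = M.root₂ ↔ (e v : N.V) = N.root₂

instance setoid (Ξ : Type) : Setoid (DoublyRootedNetwork Ξ) where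
  r := Isom
  iseqv :=
    { refl := fun M => ⟨Equiv.refl _, fun _ _ => rfl, fun _ => rfl, rfl, rfl⟩
      symm := by
        rintro M N ⟨e, h1, h2, h3, h4⟩
        refine ⟨e.symm, fun u v => ?_, fun v => ?_, ?_, ?_⟩
        · rw [← h1, e.apply_symm_apply, e.apply_symm_apply]
        · rw [← h2, e.apply_symm_apply]
        · rw [← h3, e.symm_apply_apply]
        · rw [← h4, e.symm_apply_apply]
      trans := by
        rintro M N P ⟨e, h1, h2, h3, h4⟩ ⟨f, k1, k2, k3, k4⟩
        refine ⟨e.trans f, fun u v => ?_, fun v => ?_, ?_, ?_⟩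
        · simp [k1, h1]
        · simp [k2, h2]
        · simp [h3, k3]
        · simp [h4, k4] }

/-- Exchange the two roots. -/
def swap (N : DoublyRootedNetwork Ξ) : DoublyRootedNetwork Ξ :=
  { N with root := N.root₂, root₂ := N.root }

/-- Forget the first root. -/
def atSecond (N : DoublyRootedNetwork Ξ) : RootedNetwork Ξ :=
  { N.toNetwork with root := N.root₂ }

end DoublyRootedNetwork

/-- The space of isomorphism classes of rooted networks. -/
def RootedClass (Ξ : Type) : Type 1 := Quotient (RootedNetwork.setoid Ξ)

/-- The space of isomorphism classes of doubly rooted networks. -/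
def DoublyRootedClass (Ξ : Type) : Type 1 := Quotient (DoublyRootedNetwork.setoid Ξ)

/-- The isomorphism class `[G, o]`. -/
def RootedNetwork.cls {Ξ : Type} (N : RootedNetwork Ξ) : RootedClass Ξ := Quotient.mk _ N

/-- The isomorphism class `[G, o, v]`. -/
def DoublyRootedNetwork.cls {Ξ : Type} (N : DoublyRootedNetwork Ξ) : DoublyRootedClass Ξ :=
  Quotient.mk _ N

namespace DoublyRootedClass

variable {Ξ : Type}

/-- The set of classes that agree with `M` up to radius `r`: a ball of the local metric. -/
def cyl (r : ℕ) (M : DoublyRootedNetwork Ξ) : Set (DoublyRootedClass Ξ) :=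
  {x | ∃ N : DoublyRootedNetwork Ξ, N.cls = x ∧ M.Agree r N}

/-- The topology of local convergence. -/
instance : TopologicalSpace (DoublyRootedClass Ξ) :=
  TopologicalSpace.generateFrom {C | ∃ r M, C = cyl r M}

instance : MeasurableSpace (DoublyRootedClass Ξ) := borel _

instance : BorelSpace (DoublyRootedClass Ξ) := ⟨rfl⟩

/-- `[G, o, v] ↦ [G, v, o]`. -/
def swap : DoublyRootedClass Ξ → DoublyRootedClass Ξ :=
  Quotient.lift (fun N => N.swap.cls) <| by
    rintro M N ⟨e, h1, h2, h3, h4⟩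
    exact Quotient.sound ⟨e, h1, h2, h4, h3⟩

/-- `[G, o, v] ↦ [G, v]`. -/
def atSecond : DoublyRootedClass Ξ → RootedClass Ξ :=
  Quotient.lift (fun N => N.atSecond.cls) <| by
    rintro M N ⟨e, h1, h2, h3, h4⟩
    exact Quotient.sound ⟨e, h1, h2, h4⟩

end DoublyRootedClass

namespace RootedClass

variable {Ξ : Type}

/-- The set of classes that agree with `M` up to radius `r`: a ball of the local metric. -/
def cyl (r : ℕ) (M : RootedNetwork Ξ) : Set (RootedClass Ξ) :=
  {x | ∃ N : RootedNetwork Ξ, N.cls = x ∧ M.Agree r N}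

/-- The topology of local convergence. -/
instance : TopologicalSpace (RootedClass Ξ) :=
  TopologicalSpace.generateFrom {C | ∃ r M, C = cyl r M}

instance instMeasurableSpace : MeasurableSpace (RootedClass Ξ) := borel _

instance : BorelSpace (RootedClass Ξ) := ⟨rfl⟩

/-- `[G, o] ↦ ∑ v, F [G, o, v]`. -/
noncomputable def sumSecond (F : DoublyRootedClass Ξ → ℝ≥0∞) : RootedClass Ξ → ℝ≥0∞ :=
  Quotient.lift (fun N : RootedNetwork Ξ => ∑' v : N.V, F (N.withSecond v).cls) <| by
    rintro M N ⟨e, h1, h2, h3⟩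
    rw [← e.tsum_eq]
    exact tsum_congr fun v => congrArg F (Quotient.sound ⟨e, h1, h2, h3, rfl⟩)

/-- `[G, o] ↦ g⁺_G(o) = ∑ v, g [G, o, v]`. -/
noncomputable def outMass (g : DoublyRootedClass Ξ → ℝ≥0) : RootedClass Ξ → ℝ≥0∞ :=
  sumSecond fun z => (g z : ℝ≥0∞)

/-- `[G, o] ↦ g⁻_G(o) = ∑ v, g [G, v, o]`. -/
noncomputable def inMass (g : DoublyRootedClass Ξ → ℝ≥0) : RootedClass Ξ → ℝ≥0∞ :=
  sumSecond fun z => (g z.swap : ℝ≥0∞)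

/-- The network has infinitely many vertices. -/
def IsInfinite : RootedClass Ξ → Prop :=
  Quotient.lift (fun N => Infinite N.V) <| by
    rintro M N ⟨e, -⟩
    exact propext e.infinite_iff

end RootedClass

/-- The random rooted network with distribution `μ` is unimodular: the mass transport principle. -/
def IsUnimodular {Ξ : Type} (μ : Measure (RootedClass Ξ)) : Prop :=
  ∀ g : DoublyRootedClass Ξ → ℝ≥0, Measurable g →
    ∫⁻ x, RootedClass.outMass g x ∂μ = ∫⁻ x, RootedClass.inMass g x ∂μ

/-- The distribution `ν` is the root-change of the distribution `μ` by the kernel `T`: given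
`[G, o]`, a new root is chosen with distribution `T_G(o, ·)`. -/
def IsRootChange {Ξ : Type} (T : DoublyRootedClass Ξ → ℝ≥0) (μ ν : Measure (RootedClass Ξ)) :
    Prop :=
  Measurable T ∧ (∀ᵐ x ∂μ, RootedClass.outMass T x = 1) ∧
    ∀ A : Set (RootedClass Ξ), MeasurableSet A →
      ν A = ∫⁻ x, RootedClass.sumSecond
        (fun z => (T z : ℝ≥0∞) * A.indicator (fun _ => 1) z.atSecond) x ∂μ

namespace RootedNetwork

variable {Ξ : Type}

/-- Put the marks `m` on the vertices of an unmarked rooted graph. -/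
def addMarks (N : RootedNetwork Unit) (m : N.V → Bool) : RootedNetwork Bool :=
  { N with mark := m }

open Classical in
/-- Change the mark of the root to `true`, and leave everything else. -/
noncomputable def forceRoot (N : RootedNetwork Bool) : RootedNetwork Bool :=
  { N with mark := fun v => if v = N.root then true else N.mark v }

theorem Agree.refl (r : ℕ) (M : RootedNetwork Ξ) : M.Agree r M :=
  ⟨Equiv.refl _, fun _ _ => rfl, fun _ => rfl, fun _ => Iff.rfl⟩

theorem Agree.symm {r : ℕ} {M N : RootedNetwork Ξ} (h : M.Agree r N) : N.Agree r M := by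
  obtain ⟨e, h1, h2, h3⟩ := h
  refine ⟨e.symm, fun u v => ?_, fun v => ?_, fun v => ?_⟩
  · rw [← h1, e.apply_symm_apply, e.apply_symm_apply]
  · rw [← h2, e.apply_symm_apply]
  · rw [h3, e.apply_symm_apply]

theorem Agree.trans {r : ℕ} {M N P : RootedNetwork Ξ} (h : M.Agree r N) (k : N.Agree r P) :
    M.Agree r P := by
  obtain ⟨e, h1, h2, h3⟩ := h
  obtain ⟨f, k1, k2, k3⟩ := k
  refine ⟨e.trans f, fun u v => ?_, fun v => ?_, fun v => ?_⟩
  · simp [k1, h1]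
  · simp [k2, h2]
  · rw [h3, k3]; rfl

/-- An isomorphism of balls does not increase the distance to the root. -/
theorem dist_le_of_ballIso {r : ℕ} {M N : RootedNetwork Ξ}
    (e : M.ball M.root r ≃ N.ball N.root r)
    (h1 : ∀ u v, N.mult (e u) (e v) = M.mult u v)
    (h3 : ∀ v : M.ball M.root r, (v : M.V) = M.root ↔ (e v : N.V) = N.root) (k : ℕ) :
    ∀ v : M.ball M.root r, M.dist M.root v = k → N.dist N.root (e v) ≤ k := by
  induction k with
  | zero =>
    intro v hv
    have : (v : M.V) = M.root := ((M.preconnected M.root v).dist_eq_zero_iff.mp hv).symm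
    rw [(h3 v).mp this]
    simp [Network.dist]
  | succ k ih =>
    intro v hv
    obtain ⟨w, hw, hvw⟩ := M.exists_pred hv
    have hwr : w ∈ M.ball M.root r := by
      have h5 : M.dist M.root v ≤ r := v.2
      change M.dist M.root w ≤ r
      omega
    have h4 : N.mult (e v) (e ⟨w, hwr⟩) ≠ 0 := by rw [h1]; exact hvw
    have h5 := ih ⟨w, hwr⟩ hw
    have h6 := N.dist_le_succ N.root h4
    omega

theorem Agree.mono {r s : ℕ} (hrs : r ≤ s) {M N : RootedNetwork Ξ} (h : M.Agree s N) :
    M.Agree r N := by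
  obtain ⟨f, k1, k2, k3⟩ := h.symm
  obtain ⟨e, h1, h2, h3⟩ := h
  have key : ∀ v : M.ball M.root s, (v : M.V) ∈ M.ball M.root r ↔ (e v : N.V) ∈ N.ball N.root r := by
    intro v
    constructor
    · intro hv
      exact (dist_le_of_ballIso e h1 h3 _ v rfl).trans hv
    · intro hv
      have := dist_le_of_ballIso (M := N) (N := M) e.symm
        (fun u v => by rw [← h1, e.apply_symm_apply, e.apply_symm_apply])
        (fun v => by rw [h3, e.apply_symm_apply]) _ (e v) rfl
      rw [e.symm_apply_apply] at this
      exact this.trans hv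
  refine ⟨⟨fun v => ⟨e ⟨v, M.ball_mono _ hrs v.2⟩, (key _).mp v.2⟩,
    fun w => ⟨e.symm ⟨w, N.ball_mono _ hrs w.2⟩, (key _).mpr ?_⟩, ?_, ?_⟩, ?_, ?_, ?_⟩
  · rw [e.apply_symm_apply]; exact w.2
  · intro v; simp
  · intro w; simp
  · intro u v; exact h1 _ _
  · intro v; exact h2 _
  · intro v; exact h3 ⟨v, _⟩

theorem Isom.dist_le {M N : RootedNetwork Ξ} (e : M.V ≃ N.V)
    (h1 : ∀ u v, N.mult (e u) (e v) = M.mult u v) (h3 : e M.root = N.root) (k : ℕ) :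
    ∀ v, M.dist M.root v = k → N.dist N.root (e v) ≤ k := by
  induction k with
  | zero =>
    intro v hv
    have : v = M.root := ((M.preconnected M.root v).dist_eq_zero_iff.mp hv).symm
    rw [this, h3]
    simp [Network.dist]
  | succ k ih =>
    intro v hv
    obtain ⟨w, hw, hvw⟩ := M.exists_pred hv
    have h4 : N.mult (e v) (e w) ≠ 0 := by rw [h1]; exact hvw
    have h5 := ih w hw
    have h6 := N.dist_le_succ N.root h4
    omega

theorem Isom.agree {M N : RootedNetwork Ξ} (h : M.Isom N) (r : ℕ) : M.Agree r N := by
  obtain ⟨e, h1, h2, h3⟩ := h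
  have key : ∀ v, v ∈ M.ball M.root r ↔ e v ∈ N.ball N.root r := by
    intro v
    constructor
    · intro hv
      exact (Isom.dist_le e h1 h3 _ v rfl).trans hv
    · intro hv
      have := Isom.dist_le (M := N) (N := M) e.symm
        (fun u v => by rw [← h1, e.apply_symm_apply, e.apply_symm_apply])
        (by rw [← h3, e.symm_apply_apply]) _ (e v) rfl
      rw [e.symm_apply_apply] at this
      exact this.trans hv
  refine ⟨e.subtypeEquiv key, fun u v => h1 _ _, fun v => h2 _, fun v => ?_⟩
  change (v : M.V) = M.root ↔ e v = N.root
  rw [← h3, e.apply_eq_iff_eq]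

theorem Agree.forceRoot {r : ℕ} {M N : RootedNetwork Bool} (h : M.Agree r N) :
    M.forceRoot.Agree r N.forceRoot := by
  obtain ⟨e, h1, h2, h3⟩ := h
  refine ⟨e, h1, fun v => ?_, h3⟩
  change M.ball M.root r at v
  by_cases hv : (v : M.V) = M.root
  · exact (if_pos ((h3 v).mp hv)).trans (if_pos hv).symm
  · exact (if_neg fun hh => hv ((h3 v).mpr hh)).trans ((h2 v).trans (if_neg hv).symm)

theorem addMarks_agree {r : ℕ} {M N : RootedNetwork Unit} (e : M.ball M.root r ≃ N.ball N.root r)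
    (h1 : ∀ u v, N.mult (e u) (e v) = M.mult u v)
    (h3 : ∀ v : M.ball M.root r, (v : M.V) = M.root ↔ (e v : N.V) = N.root)
    {m : M.V → Bool} {n : N.V → Bool} (hmn : ∀ v, n (e v) = m v) :
    (M.addMarks m).Agree r (N.addMarks n) :=
  ⟨e, h1, hmn, h3⟩

end RootedNetwork

namespace RootedClass

variable {Ξ : Type}

theorem cls_mem_cyl {r : ℕ} {M N : RootedNetwork Ξ} : N.cls ∈ cyl r M ↔ M.Agree r N := by
  constructor
  · rintro ⟨P, hP, h⟩
    exact h.trans (RootedNetwork.Isom.agree (Quotient.exact hP) r)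
  · exact fun h => ⟨N, rfl, h⟩

theorem exists_rep (x : RootedClass Ξ) : ∃ N : RootedNetwork Ξ, N.cls = x := Quotient.exists_rep x

theorem isOpen_cyl (r : ℕ) (M : RootedNetwork Ξ) : IsOpen (cyl r M) :=
  TopologicalSpace.isOpen_generateFrom_of_mem ⟨r, M, rfl⟩

theorem measurableSet_of_agree (r : ℕ) (S : Set (RootedClass Ξ))
    (hS : ∀ M N : RootedNetwork Ξ, M.Agree r N → M.cls ∈ S → N.cls ∈ S) : MeasurableSet S := by
  have : S = ⋃ M : {M : RootedNetwork Ξ // M.cls ∈ S}, cyl r M.1 := by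
    ext x
    obtain ⟨N, rfl⟩ := exists_rep x
    simp only [Set.mem_iUnion, cls_mem_cyl]
    exact ⟨fun h => ⟨⟨N, h⟩, RootedNetwork.Agree.refl r N⟩, fun ⟨M, h⟩ => hS _ _ h M.2⟩
  rw [this]
  exact IsOpen.measurableSet (isOpen_iUnion fun M => isOpen_cyl r _)

theorem measurable_of_agree {β : Type*} [MeasurableSpace β] (r : ℕ) (f : RootedClass Ξ → β)
    (hf : ∀ M N : RootedNetwork Ξ, M.Agree r N → f M.cls = f N.cls) : Measurable f := by
  intro s _
  refine measurableSet_of_agree r _ fun M N h hM => ?_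
  change f N.cls ∈ s
  rw [← hf M N h]
  exact hM

theorem isPiSystem_cyl : IsPiSystem {C : Set (RootedClass Ξ) | ∃ r M, C = cyl r M} := by
  have key : ∀ (r s : ℕ) (M P : RootedNetwork Ξ), r ≤ s → (cyl r M ∩ cyl s P).Nonempty →
      cyl r M ∩ cyl s P = cyl s P := by
    rintro r s M P hrs ⟨x, hx, hx'⟩
    obtain ⟨Q, rfl⟩ := exists_rep x
    rw [cls_mem_cyl] at hx hx'
    refine Set.inter_eq_right.mpr fun y hy => ?_
    obtain ⟨R, rfl⟩ := exists_rep y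
    rw [cls_mem_cyl] at hy ⊢
    exact hx.trans ((hx'.symm.trans hy).mono hrs)
  rintro _ ⟨r, M, rfl⟩ _ ⟨s, P, rfl⟩ hne
  rcases le_total r s with h | h
  · exact ⟨s, P, key r s M P h hne⟩
  · rw [Set.inter_comm] at hne ⊢
    exact ⟨r, M, key s r P M h hne⟩

theorem countable_cyl [Countable Ξ] : {C : Set (RootedClass Ξ) | ∃ r M, C = cyl r M}.Countable := by
  classical
  let Code : Type := Σ n : ℕ, (Fin n → Fin n → ℕ) × (Fin n → Ξ) × (Fin n → Bool)
  let HasCode (r : ℕ) (c : Code) (M : RootedNetwork Ξ) : Prop :=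
    ∃ e : Fin c.1 ≃ M.ball M.root r, (∀ i j, M.mult (e i) (e j) = c.2.1 i j) ∧
      (∀ i, M.mark (e i) = c.2.2.1 i) ∧ ∀ i, (e i : M.V) = M.root ↔ c.2.2.2 i = true
  have hagree : ∀ r c M N, HasCode r c M → HasCode r c N → M.Agree r N := by
    rintro r c M N ⟨e, h1, h2, h3⟩ ⟨f, k1, k2, k3⟩
    refine ⟨e.symm.trans f, fun u v => ?_, fun v => ?_, fun v => ?_⟩
    · simp only [Equiv.trans_apply]
      rw [k1, ← h1, e.apply_symm_apply, e.apply_symm_apply]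
    · simp only [Equiv.trans_apply]
      rw [k2, ← h2, e.apply_symm_apply]
    · simp only [Equiv.trans_apply]
      rw [k3, ← h3, e.apply_symm_apply]
  have hcode : ∀ r (M : RootedNetwork Ξ), ∃ c, HasCode r c M := by
    intro r M
    let e := (Finite.equivFin (M.ball M.root r)).symm
    exact ⟨⟨Nat.card (M.ball M.root r), fun i j => M.mult (e i) (e j), fun i => M.mark (e i),
      fun i => decide ((e i : M.V) = M.root)⟩, e, fun _ _ => rfl, fun _ => rfl, fun i => by simp⟩
  refine (Set.countable_range fun q : ℕ × Code =>
    {x : RootedClass Ξ | ∃ N M : RootedNetwork Ξ, N.cls = x ∧ HasCode q.1 q.2 M ∧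
      M.Agree q.1 N}).mono ?_
  rintro _ ⟨r, M, rfl⟩
  obtain ⟨c, hc⟩ := hcode r M
  refine ⟨(r, c), ?_⟩
  ext x
  constructor
  · rintro ⟨N, P, rfl, hP, hPN⟩
    exact cls_mem_cyl.mpr ((hagree r c M P hc hP).trans hPN)
  · rintro ⟨N, rfl, hN⟩
    exact ⟨N, M, rfl, hc, hN⟩

theorem measurableSpace_eq [Countable Ξ] :
    instMeasurableSpace (Ξ := Ξ) =
      MeasurableSpace.generateFrom {C | ∃ r M, C = cyl r M} := by
  have : SecondCountableTopology (RootedClass Ξ) := ⟨⟨_, countable_cyl, rfl⟩⟩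
  exact borel_eq_generateFrom_of_subbasis rfl

/-- `[G, o] ↦ [G, o]` with the mark of the root changed to `true`. -/
noncomputable def forceRoot : RootedClass Bool → RootedClass Bool :=
  Quotient.lift (fun N => N.forceRoot.cls) <| by
    rintro M N ⟨e, h1, h2, h3⟩
    refine Quotient.sound ⟨e, h1, fun v => ?_, h3⟩
    by_cases hv : v = M.root
    · subst hv
      exact (if_pos h3).trans (if_pos rfl).symm
    · exact (if_neg fun hh => hv (e.injective (hh.trans h3.symm))).trans
        ((h2 v).trans (if_neg hv).symm)

theorem measurable_forceRoot : Measurable forceRoot := by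
  refine Measurable.of_le_map (measurableSpace_eq.trans_le (MeasurableSpace.generateFrom_le ?_))
  rintro _ ⟨r, M, rfl⟩
  refine measurableSet_of_agree r _ fun N P h hN => ?_
  exact cls_mem_cyl.mpr ((cls_mem_cyl.mp (show N.forceRoot.cls ∈ cyl r M from hN)).trans
    h.forceRoot)

end RootedClass

namespace RootedNetwork

/-- The distribution of `[G, m, o]` where `(m v)` are independent `Bernoulli(p)` marks on the
vertices of the fixed rooted graph `(G, o)`. -/
noncomputable def bernoulliLaw (p : unitInterval) (N : RootedNetwork Unit) :
    Measure (RootedClass Bool) :=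
  (Measure.infinitePi fun _ : N.V => bernoulliMeasure true false p).map
    fun m => (N.addMarks m).cls

open Classical in
theorem addMarks_preimage_cyl (N : RootedNetwork Unit) (r : ℕ) (M : RootedNetwork Bool) :
    (fun m => (N.addMarks m).cls) ⁻¹' RootedClass.cyl r M =
      (N.ball N.root r).domRestrict ⁻¹' {b | M.Agree r (N.addMarks fun v =>
        if h : v ∈ N.ball N.root r then b ⟨v, h⟩ else false)} := by
  ext m
  have : (N.addMarks m).Agree r (N.addMarks fun v =>
      if h : v ∈ N.ball N.root r then (N.ball N.root r).domRestrict m ⟨v, h⟩ else false) :=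
    addMarks_agree (Equiv.refl _) (fun _ _ => rfl) (fun _ => Iff.rfl) fun v => by
      simp [Set.domRestrict]
  simp only [Set.mem_preimage, RootedClass.cls_mem_cyl, Set.mem_ofPred_eq]
  exact ⟨fun h => h.trans this, fun h => h.trans this.symm⟩

theorem measurable_addMarks (N : RootedNetwork Unit) :
    Measurable fun m : N.V → Bool => (N.addMarks m).cls := by
  refine Measurable.of_le_map
    (RootedClass.measurableSpace_eq.trans_le (MeasurableSpace.generateFrom_le ?_))
  rintro _ ⟨r, M, rfl⟩
  rw [MeasurableSpace.map_def, addMarks_preimage_cyl]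
  exact (measurable_pi_lambda _ fun i => measurable_pi_apply i.1) (Set.toFinite _).measurableSet

instance (p : unitInterval) (N : RootedNetwork Unit) : IsProbabilityMeasure (N.bernoulliLaw p) :=
  Measure.isProbabilityMeasure_map N.measurable_addMarks.aemeasurable

theorem bernoulliLaw_cyl (p : unitInterval) {r : ℕ} {N P : RootedNetwork Unit} (h : N.Agree r P)
    (M : RootedNetwork Bool) :
    N.bernoulliLaw p (RootedClass.cyl r M) = P.bernoulliLaw p (RootedClass.cyl r M) := by
  classical
  obtain ⟨e, h1, -, h3⟩ := h
  have key : ∀ Q : RootedNetwork Unit, Q.bernoulliLaw p (RootedClass.cyl r M) =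
      (Measure.infinitePi fun _ : Q.ball Q.root r => bernoulliMeasure true false p)
        {b | M.Agree r (Q.addMarks fun v =>
          if h : v ∈ Q.ball Q.root r then b ⟨v, h⟩ else false)} := by
    intro Q
    rw [bernoulliLaw, Measure.map_apply Q.measurable_addMarks
      (RootedClass.isOpen_cyl r M).measurableSet, addMarks_preimage_cyl,
      ← Measure.map_apply (measurable_pi_lambda _ fun i => measurable_pi_apply i.1) (Set.toFinite _).measurableSet,
      Measure.infinitePi_map_restrict']
  rw [key, key, ← Measure.infinitePi_map_piCongrLeft (X := fun _ => Bool)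
    (μ := fun _ => bernoulliMeasure true false p) e,
    MeasurableEquiv.map_apply]
  congr 1
  ext b
  have : (N.addMarks fun v => if h : v ∈ N.ball N.root r then b ⟨v, h⟩ else false).Agree r
      (P.addMarks fun v => if h : v ∈ P.ball P.root r then
        (MeasurableEquiv.piCongrLeft (fun _ => Bool) e) b ⟨v, h⟩ else false) := by
    refine addMarks_agree e h1 h3 fun v => ?_
    simp only [Subtype.coe_prop, dite_true, Subtype.coe_eta]
    exact Equiv.piCongrLeft_apply_apply (fun _ => Bool) e b v
  exact ⟨fun h => h.trans this, fun h => h.trans this.symm⟩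

theorem bernoulliLaw_congr (p : unitInterval) {N P : RootedNetwork Unit} (h : N.Isom P) :
    N.bernoulliLaw p = P.bernoulliLaw p := by
  refine ext_of_generate_finite _ (RootedClass.measurableSpace_eq (Ξ := Bool))
    RootedClass.isPiSystem_cyl ?_ (by simp)
  rintro _ ⟨r, M, rfl⟩
  exact bernoulliLaw_cyl p (h.agree r) M

end RootedNetwork

/-- The distribution of the network obtained from `[G, o]` by adding independent `Bernoulli(p)`
marks to the vertices. -/
noncomputable def RootedClass.bernoulliLaw (p : unitInterval) :
    RootedClass Unit → Measure (RootedClass Bool) :=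
  Quotient.lift (RootedNetwork.bernoulliLaw p) fun _ _ h => RootedNetwork.bernoulliLaw_congr p h

instance (p : unitInterval) (x : RootedClass Unit) : IsProbabilityMeasure (x.bernoulliLaw p) := by
  obtain ⟨N, rfl⟩ := RootedClass.exists_rep x
  exact inferInstanceAs (IsProbabilityMeasure (N.bernoulliLaw p))

/-- The Markov kernel that adds independent `Bernoulli(p)` marks to the vertices of a rooted
graph `[G, o]`. -/
noncomputable def bernoulliMarking (p : unitInterval) :
    Kernel (RootedClass Unit) (RootedClass Bool) where
  toFun := RootedClass.bernoulliLaw p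
  measurable' := by
    refine Measurable.measure_of_isPiSystem_of_isProbabilityMeasure
      RootedClass.measurableSpace_eq RootedClass.isPiSystem_cyl ?_
    rintro _ ⟨r, M, rfl⟩
    exact RootedClass.measurable_of_agree r _ fun N P h => RootedNetwork.bernoulliLaw_cyl p h M

instance (p : unitInterval) : IsMarkovKernel (bernoulliMarking p) :=
  ⟨fun x => inferInstanceAs (IsProbabilityMeasure (x.bernoulliLaw p))⟩

/-- The distribution of the network obtained from a random rooted graph with distribution `μ` by
adding independent `Bernoulli(p)` marks to the vertices. -/
noncomputable def bernoulliMarked (p : unitInterval) (μ : Measure (RootedClass Unit)) :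
    Measure (RootedClass Bool) := μ.bind (bernoulliMarking p)

/-! Let ν be the law of the Bernoulli marking, which is again unimodular. It suffices to find an
equivariant transport `T` that almost surely moves mass p out of every vertex, mass 1 into every
marked vertex and nothing into the others. Then p⁻¹ `T` is a kernel, and by mass transport the new
root lies in an event A with probability p⁻¹ ν(A and the root is marked). This is ν'(A), because the
mark of the root is independent of all the rest.

Such a `T` is built greedily (`exists_transport`), from supply p at every vertex, demand 1 at every
marked vertex and a positive symmetric weight whose sums are at most 1. In each of countably many
rounds, every pair (u, v) moves the product of the supply left at u, the demand left at v and the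
weight. If u kept supply and v kept demand for ever, each round would move at least a fixed positive
amount from u to v, which is absurd. So in each network all supply is used or all demand is met. Let
A be the invariant event that some supply is left. On A all demand is met, so by mass transport the
mass leaving the root has integral ν(A and the root is marked) over A. If the mark of the root is
independent of A, this is p ν(A), so the outgoing mass, being at most p, equals p almost surely.
Comparing means then shows that all demand is met as well.

Infiniteness enters through the independence of the root's mark from invariant events
(`bernoulliMarked_inter_rootMarked_of_invariant`). Approximate A by an event S that sees only the
ball of radius r, and take a transport on the unmarked graph that moves all mass farther than r and
has incoming mass at most 1 (`IsUnimodular.exists_far_transport`). By invariance A may be tested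
where the mass lands; there it is nearly S, which does not see the mark of the starting vertex. The
far transport comes from the same greedy scheme, with supply and demand 1 and weight 0 at short
distances. The set of vertices with unmet demand is almost surely empty or infinite
(`IsUnimodular.ae_vertexCount_eq_top`). If it is infinite, every vertex has such a vertex far away,
so all supply is used; if it is empty, mass transport gives the same. -/

namespace Network

variable {Ξ : Type}

/-! ### Distances, and distances to a vertex inside a ball -/

theorem dist_triangle (N : Network Ξ) (u v w : N.V) : N.dist u w ≤ N.dist u v + N.dist v w := by
  obtain ⟨p, hp⟩ := (N.preconnected u v).exists_walk_length_eq_dist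
  obtain ⟨q, hq⟩ := (N.preconnected v w).exists_walk_length_eq_dist
  have := SimpleGraph.dist_le (p.append q)
  rw [SimpleGraph.Walk.length_append, hp, hq] at this
  exact this

theorem dist_comm (N : Network Ξ) (u v : N.V) : N.dist u v = N.dist v u :=
  SimpleGraph.dist_comm

end Network

namespace RootedNetwork

variable {Ξ : Type}

/-- An isomorphism of balls does not increase the distances to a vertex well inside the ball. -/
theorem dist_le_of_ballIso_of_le {R r : ℕ} {M N : RootedNetwork Ξ}
    (e : M.ball M.root R ≃ N.ball N.root R)
    (h1 : ∀ u v, N.mult (e u) (e v) = M.mult u v)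
    (a : M.ball M.root R) (ha : M.dist M.root a + r ≤ R) (k : ℕ) (hk : k ≤ r) :
    ∀ v : M.ball M.root R, M.dist a v = k → N.dist (e a) (e v) ≤ k := by
  induction k with
  | zero =>
    intro v hv
    have : a = v := Subtype.ext ((M.preconnected a v).dist_eq_zero_iff.mp hv)
    subst this
    simp [Network.dist]
  | succ k ih =>
    intro v hv
    obtain ⟨w, hw, hvw⟩ := M.exists_pred hv
    -- A geodesic from `a` of length at most `r` cannot leave the ball of radius `R`.
    have hwr : w ∈ M.ball M.root R := by
      have h5 := M.dist_triangle M.root a w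
      change M.dist M.root w ≤ R
      omega
    have h4 : N.mult (e v) (e ⟨w, hwr⟩) ≠ 0 := by rw [h1]; exact hvw
    have h5 := ih (by omega) ⟨w, hwr⟩ hw
    have h6 := N.dist_le_succ (e a : N.V) h4
    omega

end RootedNetwork

/-! ### Agreement of doubly rooted networks and exchange of the roots -/

namespace DoublyRootedNetwork

variable {Ξ : Type}

open Classical in
/-- Record the second root in the marks. -/
noncomputable def encode (N : DoublyRootedNetwork Ξ) : RootedNetwork (Ξ × Bool) :=
  { N.toRootedNetwork with mark := fun v => (N.mark v, decide (v = N.root₂)) }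

/-- Once the second root is a mark, the equivalence properties, monotonicity in the radius and
countability of the cylinders carry over from rooted networks. -/
theorem encode_agree {r : ℕ} {M N : DoublyRootedNetwork Ξ} :
    M.encode.Agree r N.encode ↔ M.Agree r N := by
  constructor
  · rintro ⟨e, h1, h2, h3⟩
    refine ⟨e, h1, fun v => congrArg Prod.fst (h2 v), h3, fun v => ?_⟩
    have := congrArg Prod.snd (h2 v)
    exact (decide_eq_decide.mp this).symm
  · rintro ⟨e, h1, h2, h3, h4⟩
    exact ⟨e, h1, fun v => Prod.ext (h2 v) (decide_eq_decide.mpr (h4 v).symm), h3⟩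

theorem Isom.encode {M N : DoublyRootedNetwork Ξ} (h : M.Isom N) : M.encode.Isom N.encode := by
  obtain ⟨e, h1, h2, h3, h4⟩ := h
  refine ⟨e, h1, fun v => Prod.ext (h2 v) (decide_eq_decide.mpr ?_), h3⟩
  exact ⟨fun h => e.injective (h.trans h4.symm), fun h => (congrArg e h).trans h4⟩

theorem Agree.refl (r : ℕ) (M : DoublyRootedNetwork Ξ) : M.Agree r M :=
  encode_agree.mp (.refl r _)

theorem Agree.symm {r : ℕ} {M N : DoublyRootedNetwork Ξ} (h : M.Agree r N) : N.Agree r M :=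
  encode_agree.mp (encode_agree.mpr h).symm

theorem Agree.trans {r : ℕ} {M N P : DoublyRootedNetwork Ξ} (h : M.Agree r N) (k : N.Agree r P) :
    M.Agree r P :=
  encode_agree.mp ((encode_agree.mpr h).trans (encode_agree.mpr k))

theorem Agree.mono {r s : ℕ} (hrs : r ≤ s) {M N : DoublyRootedNetwork Ξ} (h : M.Agree s N) :
    M.Agree r N :=
  encode_agree.mp ((encode_agree.mpr h).mono hrs)

theorem Isom.agree {M N : DoublyRootedNetwork Ξ} (h : M.Isom N) (r : ℕ) : M.Agree r N :=
  encode_agree.mp (h.encode.agree r)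

theorem Agree.toRootedNetwork {r : ℕ} {M N : DoublyRootedNetwork Ξ} (h : M.Agree r N) :
    M.toRootedNetwork.Agree r N.toRootedNetwork := by
  obtain ⟨e, h1, h2, h3, -⟩ := h
  exact ⟨e, h1, h2, h3⟩

/-- The distance between the two roots. -/
noncomputable def rootDist (N : DoublyRootedNetwork Ξ) : ℕ := N.dist N.root N.root₂

/-- The radius is just large enough for the ball to contain the second root of `M`. -/
theorem Agree.rootDist_le {M N : DoublyRootedNetwork Ξ} (h : M.Agree M.rootDist N) :
    N.rootDist ≤ M.rootDist := by
  obtain ⟨e, h1, h2, h3, h4⟩ := h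
  have hM : M.root₂ ∈ M.ball M.root M.rootDist := le_refl M.rootDist
  have := RootedNetwork.dist_le_of_ballIso (M := M.toRootedNetwork) (N := N.toRootedNetwork)
    e h1 h3 _ ⟨M.root₂, hM⟩ rfl
  rw [(h4 ⟨M.root₂, hM⟩).mp rfl] at this
  exact this

theorem Agree.rootDist_eq {M N : DoublyRootedNetwork Ξ} (h : M.Agree M.rootDist N) :
    N.rootDist = M.rootDist :=
  le_antisymm h.rootDist_le (h.mono h.rootDist_le).symm.rootDist_le

/-- The ball of radius `r` around the second root lies in the given ball, whose isomorphism respects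
distances up to `r` from that root. This makes the exchange of the roots continuous. -/
theorem Agree.swap {r : ℕ} {M N : DoublyRootedNetwork Ξ} (h : M.Agree (M.rootDist + r) N) :
    M.swap.Agree r N.swap := by
  have hd : N.rootDist = M.rootDist := (h.mono (Nat.le_add_right _ _)).rootDist_eq
  obtain ⟨e, h1, h2, h3, h4⟩ := h
  have subM : ∀ v : M.V, M.dist M.root₂ v ≤ r → v ∈ M.ball M.root (M.rootDist + r) := fun v hv =>
    (M.dist_triangle M.root M.root₂ v).trans (Nat.add_le_add_left hv _)
  have subN : ∀ v : N.V, N.dist N.root₂ v ≤ r → v ∈ N.ball N.root (M.rootDist + r) := fun v hv =>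
    (N.dist_triangle N.root N.root₂ v).trans (hd ▸ Nat.add_le_add_left hv _)
  have hM : M.root₂ ∈ M.ball M.root (M.rootDist + r) := Nat.le_add_right _ _
  have hN : N.root₂ ∈ N.ball N.root (M.rootDist + r) := hd ▸ Nat.le_add_right N.rootDist r
  have he : e ⟨M.root₂, hM⟩ = ⟨N.root₂, hN⟩ := Subtype.ext ((h4 ⟨M.root₂, hM⟩).mp rfl)
  have he' : e.symm ⟨N.root₂, hN⟩ = ⟨M.root₂, hM⟩ := by rw [← he, e.symm_apply_apply]
  have key : ∀ v : M.ball M.root (M.rootDist + r), M.dist M.root₂ v ≤ r ↔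
      N.dist N.root₂ (e v) ≤ r := by
    intro v
    constructor
    · intro hv
      have := RootedNetwork.dist_le_of_ballIso_of_le (M := M.toRootedNetwork)
        (N := N.toRootedNetwork) e h1 ⟨M.root₂, hM⟩ le_rfl _ hv v rfl
      rw [he] at this
      exact this.trans hv
    · intro hv
      have := RootedNetwork.dist_le_of_ballIso_of_le (M := N.toRootedNetwork)
        (N := M.toRootedNetwork) e.symm
        (fun u v => by rw [← h1, e.apply_symm_apply, e.apply_symm_apply])
        ⟨N.root₂, hN⟩ (Nat.add_le_add_right hd.le r) _ hv (e v) rfl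
      rw [he', e.symm_apply_apply] at this
      exact this.trans hv
  let f : M.ball M.root₂ r ≃ N.ball N.root₂ r :=
    { toFun := fun v => ⟨(e ⟨v, subM v v.2⟩ : N.V), (key _).mp v.2⟩
      invFun := fun w => ⟨(e.symm ⟨w, subN w w.2⟩ : M.V),
        (key _).mpr (by rw [e.apply_symm_apply]; exact w.2)⟩
      left_inv := fun v => by simp
      right_inv := fun v => by simp }
  exact ⟨f, fun u v => h1 _ _, fun v => h2 _, fun v => h4 ⟨v.1, subM v.1 v.2⟩,
    fun v => h3 ⟨v.1, subM v.1 v.2⟩⟩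

end DoublyRootedNetwork

/-! ### Borel structure on doubly rooted classes -/

namespace DoublyRootedClass

variable {Ξ : Type}

theorem exists_rep (z : DoublyRootedClass Ξ) : ∃ N : DoublyRootedNetwork Ξ, N.cls = z :=
  Quotient.exists_rep z

theorem exists_rep_withSecond (z : DoublyRootedClass Ξ) :
    ∃ (N : RootedNetwork Ξ) (v : N.V), (N.withSecond v).cls = z := by
  obtain ⟨M, rfl⟩ := exists_rep z
  exact ⟨M.toRootedNetwork, M.root₂, rfl⟩

theorem cls_mem_cyl {r : ℕ} {M N : DoublyRootedNetwork Ξ} : N.cls ∈ cyl r M ↔ M.Agree r N := by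
  constructor
  · rintro ⟨P, hP, h⟩
    exact h.trans (DoublyRootedNetwork.Isom.agree (Quotient.exact hP) r)
  · exact fun h => ⟨N, rfl, h⟩

theorem isOpen_cyl (r : ℕ) (M : DoublyRootedNetwork Ξ) : IsOpen (cyl r M) :=
  TopologicalSpace.isOpen_generateFrom_of_mem ⟨r, M, rfl⟩

/-- The radius may depend on the class: exchanging the roots or measuring their distance needs a
radius that grows with this distance. -/
theorem isOpen_of_agree (S : Set (DoublyRootedClass Ξ))
    (hS : ∀ M : DoublyRootedNetwork Ξ, M.cls ∈ S → ∃ r, ∀ N : DoublyRootedNetwork Ξ,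
      M.Agree r N → N.cls ∈ S) : IsOpen S := by
  choose! r hr using hS
  have : S = ⋃ M : {M : DoublyRootedNetwork Ξ // M.cls ∈ S}, cyl (r M.1) M.1 := by
    ext z
    obtain ⟨N, rfl⟩ := exists_rep z
    simp only [Set.mem_iUnion, cls_mem_cyl]
    exact ⟨fun h => ⟨⟨N, h⟩, DoublyRootedNetwork.Agree.refl _ N⟩, fun ⟨M, h⟩ => hr M M.2 N h⟩
  rw [this]
  exact isOpen_iUnion fun M => isOpen_cyl _ _

theorem measurable_of_agree {β : Type*} [MeasurableSpace β] (f : DoublyRootedClass Ξ → β)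
    (hf : ∀ M : DoublyRootedNetwork Ξ, ∃ r, ∀ N : DoublyRootedNetwork Ξ,
      M.Agree r N → f N.cls = f M.cls) : Measurable f := by
  intro s _
  refine (isOpen_of_agree _ fun M hM => ?_).measurableSet
  obtain ⟨r, hr⟩ := hf M
  refine ⟨r, fun N h => ?_⟩
  change f N.cls ∈ s
  rw [hr N h]
  exact hM

theorem isPiSystem_cyl :
    IsPiSystem {C : Set (DoublyRootedClass Ξ) | ∃ r M, C = cyl r M} := by
  have key : ∀ (r s : ℕ) (M P : DoublyRootedNetwork Ξ), r ≤ s →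
      (cyl r M ∩ cyl s P).Nonempty → cyl r M ∩ cyl s P = cyl s P := by
    rintro r s M P hrs ⟨x, hx, hx'⟩
    obtain ⟨Q, rfl⟩ := exists_rep x
    rw [cls_mem_cyl] at hx hx'
    refine Set.inter_eq_right.mpr fun y hy => ?_
    obtain ⟨R, rfl⟩ := exists_rep y
    rw [cls_mem_cyl] at hy ⊢
    exact hx.trans ((hx'.symm.trans hy).mono hrs)
  rintro _ ⟨r, M, rfl⟩ _ ⟨s, P, rfl⟩ hne
  rcases le_total r s with h | h
  · exact ⟨s, P, key r s M P h hne⟩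
  · rw [Set.inter_comm] at hne ⊢
    exact ⟨r, M, key s r P M h hne⟩

/-- Record the second root in the marks. -/
noncomputable def encode : DoublyRootedClass Ξ → RootedClass (Ξ × Bool) :=
  Quotient.lift (fun N => N.encode.cls) fun _ _ h => Quotient.sound h.encode

theorem encode_preimage_cyl (r : ℕ) (M : DoublyRootedNetwork Ξ) :
    encode ⁻¹' RootedClass.cyl r M.encode = cyl r M := by
  ext z
  obtain ⟨N, rfl⟩ := exists_rep z
  rw [cls_mem_cyl, ← DoublyRootedNetwork.encode_agree]
  exact RootedClass.cls_mem_cyl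

theorem countable_cyl [Countable Ξ] :
    {C : Set (DoublyRootedClass Ξ) | ∃ r M, C = cyl r M}.Countable := by
  refine ((RootedClass.countable_cyl (Ξ := Ξ × Bool)).image (encode ⁻¹' ·)).mono ?_
  rintro _ ⟨r, M, rfl⟩
  exact ⟨_, ⟨r, M.encode, rfl⟩, encode_preimage_cyl r M⟩

theorem measurableSpace_eq [Countable Ξ] :
    instMeasurableSpace (Ξ := Ξ) =
      MeasurableSpace.generateFrom {C | ∃ r M, C = cyl r M} := by
  have : SecondCountableTopology (DoublyRootedClass Ξ) := ⟨⟨_, countable_cyl, rfl⟩⟩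
  exact borel_eq_generateFrom_of_subbasis rfl

/-- `[G, o, v] ↦ [G, o]`. -/
def atFirst : DoublyRootedClass Ξ → RootedClass Ξ :=
  Quotient.lift (fun N => N.toRootedNetwork.cls) <| by
    rintro M N ⟨e, h1, h2, h3, -⟩
    exact Quotient.sound ⟨e, h1, h2, h3⟩

theorem measurable_atFirst : Measurable (atFirst (Ξ := Ξ)) := by
  refine Continuous.measurable (continuous_generateFrom_iff.mpr ?_)
  rintro _ ⟨r, P, rfl⟩
  refine isOpen_of_agree _ fun M hM => ⟨r, fun N h => ?_⟩
  exact RootedClass.cls_mem_cyl.mpr ((RootedClass.cls_mem_cyl.mp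
    (show M.toRootedNetwork.cls ∈ _ from hM)).trans h.toRootedNetwork)

theorem measurable_swap : Measurable (swap (Ξ := Ξ)) := by
  refine Continuous.measurable (continuous_generateFrom_iff.mpr ?_)
  rintro _ ⟨r, P, rfl⟩
  refine isOpen_of_agree _ fun M hM => ⟨M.rootDist + r, fun N h => ?_⟩
  exact cls_mem_cyl.mpr ((cls_mem_cyl.mp (show M.swap.cls ∈ _ from hM)).trans h.swap)

theorem atFirst_swap (z : DoublyRootedClass Ξ) : z.swap.atFirst = z.atSecond := by
  obtain ⟨N, rfl⟩ := exists_rep z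
  rfl

theorem atSecond_swap (z : DoublyRootedClass Ξ) : z.swap.atSecond = z.atFirst := by
  obtain ⟨N, rfl⟩ := exists_rep z
  rfl

theorem measurable_atSecond : Measurable (atSecond (Ξ := Ξ)) := by
  have : atSecond (Ξ := Ξ) = atFirst ∘ swap := funext fun z => (atFirst_swap z).symm
  rw [this]
  exact measurable_atFirst.comp measurable_swap

/-- The distance between the two roots. -/
noncomputable def rootDist : DoublyRootedClass Ξ → ℕ :=
  Quotient.lift DoublyRootedNetwork.rootDist fun M _ h =>
    (DoublyRootedNetwork.Agree.rootDist_eq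
      (DoublyRootedNetwork.Isom.agree h M.rootDist)).symm

theorem measurable_rootDist : Measurable (rootDist (Ξ := Ξ)) :=
  measurable_of_agree _ fun M => ⟨M.rootDist, fun _ h => h.rootDist_eq⟩

theorem rootDist_swap (z : DoublyRootedClass Ξ) : z.swap.rootDist = z.rootDist := by
  obtain ⟨N, rfl⟩ := exists_rep z
  exact N.dist_comm _ _

end DoublyRootedClass

/-! ### Measurability of sums over the second root -/

namespace RootedNetwork

variable {Ξ : Type}

instance (N : RootedNetwork Ξ) (k : ℕ) : Finite {v : N.V // N.dist N.root v = k} :=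
  ((N.ball_finite N.root k).subset fun _ hv => le_of_eq hv).to_subtype

/-- The counting measure on the classes `[G, o, v]` with `v` at distance `k` from `o`. -/
noncomputable def sphereMeasure (k : ℕ) (N : RootedNetwork Ξ) : Measure (DoublyRootedClass Ξ) :=
  Measure.sum fun v : {v : N.V // N.dist N.root v = k} => Measure.dirac (N.withSecond v).cls

instance (k : ℕ) (N : RootedNetwork Ξ) : IsFiniteMeasure (N.sphereMeasure k) := by
  refine ⟨?_⟩
  have := Fintype.ofFinite {v : N.V // N.dist N.root v = k}
  rw [sphereMeasure, Measure.sum_apply _ MeasurableSet.univ, tsum_fintype]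
  exact ENNReal.sum_lt_top.mpr fun v _ => measure_lt_top _ _

theorem lintegral_sphereMeasure (k : ℕ) (N : RootedNetwork Ξ) {F : DoublyRootedClass Ξ → ℝ≥0∞}
    (hF : Measurable F) :
    ∫⁻ z, F z ∂N.sphereMeasure k =
      ∑' v : {v : N.V // N.dist N.root v = k}, F (N.withSecond v).cls := by
  rw [sphereMeasure, lintegral_sum_measure]
  exact tsum_congr fun v => lintegral_dirac' _ hF

/-- An isomorphism of balls of radius `R ≥ k` preserves the distance to the root, so it matches the
spheres of radius `k`. -/
theorem sphereMeasure_congr {k R : ℕ} (hk : k ≤ R) {N P : RootedNetwork Ξ} (h : N.Agree R P)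
    {S : Set (DoublyRootedClass Ξ)} (hS : MeasurableSet S)
    (hSR : ∀ M Q : DoublyRootedNetwork Ξ, M.Agree R Q → (M.cls ∈ S ↔ Q.cls ∈ S)) :
    N.sphereMeasure k S = P.sphereMeasure k S := by
  obtain ⟨e, h1, h2, h3⟩ := h
  have hd : ∀ v : N.ball N.root R, P.dist P.root (e v) = N.dist N.root v := fun v => by
    refine le_antisymm (dist_le_of_ballIso e h1 h3 _ v rfl) ?_
    have := dist_le_of_ballIso (M := P) (N := N) e.symm
      (fun u v => by rw [← h1, e.apply_symm_apply, e.apply_symm_apply])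
      (fun v => by rw [h3, e.apply_symm_apply]) _ (e v) rfl
    rwa [e.symm_apply_apply] at this
  let f : {v : N.V // N.dist N.root v = k} ≃ {v : P.V // P.dist P.root v = k} :=
    { toFun := fun v => ⟨e ⟨v, v.2.le.trans hk⟩, (hd _).trans v.2⟩
      invFun := fun w => ⟨e.symm ⟨w, w.2.le.trans hk⟩, by
        rw [← hd, e.apply_symm_apply]; exact w.2⟩
      left_inv := fun v => Subtype.ext (by
        change ((e.symm (e ⟨v, v.2.le.trans hk⟩) : N.ball N.root R) : N.V) = v
        rw [e.symm_apply_apply])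
      right_inv := fun w => Subtype.ext (by
        change ((e (e.symm ⟨w, w.2.le.trans hk⟩) : P.ball P.root R) : P.V) = w
        rw [e.apply_symm_apply]) }
  rw [sphereMeasure, sphereMeasure, Measure.sum_apply _ hS, Measure.sum_apply _ hS,
    ← f.tsum_eq]
  refine tsum_congr fun v => ?_
  rw [Measure.dirac_apply' _ hS, Measure.dirac_apply' _ hS]
  have hA : (N.withSecond v).Agree R (P.withSecond (f v)) := by
    refine ⟨e, h1, h2, h3, fun u => ?_⟩
    change N.ball N.root R at u
    change (u : N.V) = v.1 ↔ (e u : P.V) = e ⟨v, v.2.le.trans hk⟩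
    rw [← Subtype.ext_iff, e.apply_eq_iff_eq, Subtype.ext_iff]
  classical
  rw [Set.indicator_apply, Set.indicator_apply]
  exact if_congr (hSR _ _ hA) rfl rfl

end RootedNetwork

namespace RootedClass

variable {Ξ : Type}

/-- A representative of a class. -/
noncomputable def out (x : RootedClass Ξ) : RootedNetwork Ξ := Quotient.out x

theorem cls_out (x : RootedClass Ξ) : x.out.cls = x := Quotient.out_eq x

theorem isom_out_cls (N : RootedNetwork Ξ) : N.cls.out.Isom N := Quotient.mk_out N

/-- On cylinders the values are local functions of the class. Finite measures allow the π-λ theorem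
to extend measurability to all Borel sets. -/
theorem measurable_sphereMeasure [Countable Ξ] (k : ℕ) :
    Measurable fun x : RootedClass Ξ => x.out.sphereMeasure k := by
  have key : ∀ (r : ℕ) (S : Set (DoublyRootedClass Ξ)), MeasurableSet S →
      (∀ M Q : DoublyRootedNetwork Ξ, M.Agree r Q → (M.cls ∈ S ↔ Q.cls ∈ S)) →
      Measurable fun x : RootedClass Ξ => x.out.sphereMeasure k S := by
    intro r S hS hSr
    refine measurable_of_agree (max k r) _ fun M N h => ?_
    refine RootedNetwork.sphereMeasure_congr (le_max_left k r) ?_ hS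
      fun M Q hMQ => hSr M Q (hMQ.mono (le_max_right k r))
    exact ((isom_out_cls M).agree _).trans (h.trans ((isom_out_cls N).agree _).symm)
  refine Measurable.measure_of_isPiSystem DoublyRootedClass.measurableSpace_eq
    DoublyRootedClass.isPiSystem_cyl ?_ (key 0 _ MeasurableSet.univ fun _ _ _ => Iff.rfl)
  rintro _ ⟨r, M, rfl⟩
  refine key r _ (DoublyRootedClass.isOpen_cyl r M).measurableSet fun P Q h => ?_
  rw [DoublyRootedClass.cls_mem_cyl, DoublyRootedClass.cls_mem_cyl]
  exact ⟨fun hP => hP.trans h, fun hQ => hQ.trans h.symm⟩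

theorem sumSecond_cls (F : DoublyRootedClass Ξ → ℝ≥0∞) (N : RootedNetwork Ξ) :
    sumSecond F N.cls = ∑' v : N.V, F (N.withSecond v).cls := rfl

/-- Cut into spheres, the sum is a countable sum of integrals against measurable families of
measures. -/
theorem measurable_sumSecond [Countable Ξ] {F : DoublyRootedClass Ξ → ℝ≥0∞} (hF : Measurable F) :
    Measurable (sumSecond F) := by
  have : sumSecond F = fun x : RootedClass Ξ =>
      ∑' k, ∫⁻ z, F z ∂x.out.sphereMeasure k := by
    funext x
    have hx : x.out.cls = x := x.cls_out
    simp_rw [RootedNetwork.lintegral_sphereMeasure _ _ hF]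
    rw [← ENNReal.tsum_sigma (β := fun k => {v : x.out.V //
      x.out.dist x.out.root v = k})
      fun _ v => F (x.out.withSecond v).cls]
    conv_lhs => rw [← hx, sumSecond_cls]
    exact ((Equiv.sigmaFiberEquiv (x.out.dist x.out.root)).tsum_eq
      fun v => F (x.out.withSecond v).cls).symm
  rw [this]
  exact Measurable.tsum fun k =>
    (Measure.measurable_lintegral hF).comp (measurable_sphereMeasure k)

theorem sumSecond_mono {F F' : DoublyRootedClass Ξ → ℝ≥0∞} (h : ∀ z, F z ≤ F' z)
    (x : RootedClass Ξ) : sumSecond F x ≤ sumSecond F' x := by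
  obtain ⟨N, rfl⟩ := exists_rep x
  exact ENNReal.tsum_le_tsum fun v => h _

theorem sumSecond_add (F F' : DoublyRootedClass Ξ → ℝ≥0∞) (x : RootedClass Ξ) :
    sumSecond (fun z => F z + F' z) x = sumSecond F x + sumSecond F' x := by
  obtain ⟨N, rfl⟩ := exists_rep x
  exact ENNReal.tsum_add

theorem sumSecond_tsum {ι : Type*} (F : ι → DoublyRootedClass Ξ → ℝ≥0∞) (x : RootedClass Ξ) :
    sumSecond (fun z => ∑' i, F i z) x = ∑' i, sumSecond (F i) x := by
  obtain ⟨N, rfl⟩ := exists_rep x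
  exact ENNReal.tsum_comm

theorem sumSecond_atFirst_mul (f : RootedClass Ξ → ℝ≥0∞) (F : DoublyRootedClass Ξ → ℝ≥0∞)
    (x : RootedClass Ξ) :
    sumSecond (fun z => f z.atFirst * F z) x = f x * sumSecond F x := by
  obtain ⟨N, rfl⟩ := exists_rep x
  exact ENNReal.tsum_mul_left (f := fun v => F (N.withSecond v).cls) (a := f N.cls)

theorem sumSecond_const_mul (c : ℝ≥0∞) (F : DoublyRootedClass Ξ → ℝ≥0∞) (x : RootedClass Ξ) :
    sumSecond (fun z => c * F z) x = c * sumSecond F x :=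
  sumSecond_atFirst_mul (fun _ => c) F x

end RootedClass

/-! ### Forms of the mass transport principle -/

/-- The mass transport principle for functions with values in `[0, ∞]`. -/
theorem IsUnimodular.lintegral_sumSecond {Ξ : Type} [Countable Ξ] {μ : Measure (RootedClass Ξ)}
    (hμ : IsUnimodular μ) {g : DoublyRootedClass Ξ → ℝ≥0∞} (hg : Measurable g) :
    ∫⁻ x, RootedClass.sumSecond g x ∂μ =
      ∫⁻ x, RootedClass.sumSecond (fun z => g z.swap) x ∂μ := by
  -- Unimodularity tests finite functions only, so `g` is written as a countable sum of such
  -- functions.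
  obtain ⟨φ, hφ, hs⟩ : ∃ φ : ℕ → DoublyRootedClass Ξ → ℝ≥0, (∀ n, Measurable (φ n)) ∧
      g = fun z => ∑' n, (φ n z : ℝ≥0∞) :=
    ⟨fun n => SimpleFunc.eapproxDiff g n, fun n => SimpleFunc.measurable _,
      funext fun z => (SimpleFunc.tsum_eapproxDiff g hg z).symm⟩
  have h1 : ∀ x, RootedClass.sumSecond g x = ∑' n, RootedClass.outMass (φ n) x := fun x => by
    rw [hs]
    exact RootedClass.sumSecond_tsum (fun n z => (φ n z : ℝ≥0∞)) x
  have h2 : ∀ x, RootedClass.sumSecond (fun z => g z.swap) x =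
      ∑' n, RootedClass.inMass (φ n) x := fun x => by
    rw [hs]
    exact RootedClass.sumSecond_tsum (fun n z => (φ n z.swap : ℝ≥0∞)) x
  simp_rw [h1, h2]
  rw [lintegral_tsum, lintegral_tsum]
  · exact tsum_congr fun n => hμ _ (hφ n)
  · exact fun n => (RootedClass.measurable_sumSecond ((hφ n).coe_nnreal_ennreal.comp
      DoublyRootedClass.measurable_swap)).aemeasurable
  · exact fun n => (RootedClass.measurable_sumSecond (hφ n).coe_nnreal_ennreal).aemeasurable

/-- Unimodularity gives the mass transport principle weighted by a function of one endpoint. -/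
theorem IsUnimodular.lintegral_mul_sumSecond {Ξ : Type} [Countable Ξ]
    {μ : Measure (RootedClass Ξ)} (hμ : IsUnimodular μ) {g : DoublyRootedClass Ξ → ℝ≥0∞}
    (hg : Measurable g) {f : RootedClass Ξ → ℝ≥0∞} (hf : Measurable f) :
    ∫⁻ x, RootedClass.sumSecond (fun z => g z * f z.atSecond) x ∂μ =
      ∫⁻ x, f x * RootedClass.sumSecond (fun z => g z.swap) x ∂μ := by
  rw [hμ.lintegral_sumSecond (g := fun z => g z * f z.atSecond)
    (hg.mul (hf.comp DoublyRootedClass.measurable_atSecond))]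
  refine lintegral_congr fun x => ?_
  rw [← RootedClass.sumSecond_atFirst_mul]
  simp_rw [DoublyRootedClass.atSecond_swap, mul_comm]

/-! ### Bernoulli marks and unimodularity of the marked network -/

namespace DoublyRootedNetwork

/-- Put the marks `m` on the vertices of an unmarked doubly rooted graph. -/
def addMarks (N : DoublyRootedNetwork Unit) (m : N.V → Bool) : DoublyRootedNetwork Bool :=
  { N with mark := m }

theorem addMarks_agree {r : ℕ} {M N : DoublyRootedNetwork Unit}
    (e : M.ball M.root r ≃ N.ball N.root r)
    (h1 : ∀ u v, N.mult (e u) (e v) = M.mult u v)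
    (h3 : ∀ v : M.ball M.root r, (v : M.V) = M.root ↔ (e v : N.V) = N.root)
    (h4 : ∀ v : M.ball M.root r, (v : M.V) = M.root₂ ↔ (e v : N.V) = N.root₂)
    {m : M.V → Bool} {n : N.V → Bool} (hmn : ∀ v, n (e v) = m v) :
    (M.addMarks m).Agree r (N.addMarks n) :=
  ⟨e, h1, hmn, h3, h4⟩

/-- The distribution of `[G, m, o, v]` where the `m u` are independent `Bernoulli(p)` marks on the
vertices of the fixed doubly rooted graph `(G, o, v)`. -/
noncomputable def bernoulliLaw (p : unitInterval) (N : DoublyRootedNetwork Unit) :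
    Measure (DoublyRootedClass Bool) :=
  (Measure.infinitePi fun _ : N.V => bernoulliMeasure true false p).map
    fun m => (N.addMarks m).cls

open Classical in
theorem addMarks_preimage_cyl (N : DoublyRootedNetwork Unit) (r : ℕ)
    (M : DoublyRootedNetwork Bool) :
    (fun m => (N.addMarks m).cls) ⁻¹' DoublyRootedClass.cyl r M =
      (N.ball N.root r).domRestrict ⁻¹' {b | M.Agree r (N.addMarks fun v =>
        if h : v ∈ N.ball N.root r then b ⟨v, h⟩ else false)} := by
  ext m
  have : (N.addMarks m).Agree r (N.addMarks fun v =>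
      if h : v ∈ N.ball N.root r then (N.ball N.root r).domRestrict m ⟨v, h⟩ else false) :=
    addMarks_agree (Equiv.refl _) (fun _ _ => rfl) (fun _ => Iff.rfl) (fun _ => Iff.rfl)
      fun v => by simp [Set.domRestrict]
  simp only [Set.mem_preimage, DoublyRootedClass.cls_mem_cyl, Set.mem_ofPred_eq]
  exact ⟨fun h => h.trans this, fun h => h.trans this.symm⟩

theorem measurable_addMarks (N : DoublyRootedNetwork Unit) :
    Measurable fun m : N.V → Bool => (N.addMarks m).cls := by
  refine Measurable.of_le_map
    (DoublyRootedClass.measurableSpace_eq.trans_le (MeasurableSpace.generateFrom_le ?_))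
  rintro _ ⟨r, M, rfl⟩
  rw [MeasurableSpace.map_def, addMarks_preimage_cyl]
  exact (measurable_pi_lambda _ fun i => measurable_pi_apply i.1) (Set.toFinite _).measurableSet

instance (p : unitInterval) (N : DoublyRootedNetwork Unit) :
    IsProbabilityMeasure (N.bernoulliLaw p) :=
  Measure.isProbabilityMeasure_map N.measurable_addMarks.aemeasurable

/-- A cylinder of radius `r` sees only the marks in the ball; they are i.i.d., and the ball
isomorphism relabels them. -/
theorem bernoulliLaw_cyl (p : unitInterval) {r : ℕ} {N P : DoublyRootedNetwork Unit}
    (h : N.Agree r P) (M : DoublyRootedNetwork Bool) :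
    N.bernoulliLaw p (DoublyRootedClass.cyl r M) =
      P.bernoulliLaw p (DoublyRootedClass.cyl r M) := by
  classical
  obtain ⟨e, h1, -, h3, h4⟩ := h
  have key : ∀ Q : DoublyRootedNetwork Unit, Q.bernoulliLaw p (DoublyRootedClass.cyl r M) =
      (Measure.infinitePi fun _ : Q.ball Q.root r => bernoulliMeasure true false p)
        {b | M.Agree r (Q.addMarks fun v =>
          if h : v ∈ Q.ball Q.root r then b ⟨v, h⟩ else false)} := by
    intro Q
    rw [bernoulliLaw, Measure.map_apply Q.measurable_addMarks
      (DoublyRootedClass.isOpen_cyl r M).measurableSet, addMarks_preimage_cyl,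
      ← Measure.map_apply (measurable_pi_lambda _ fun i => measurable_pi_apply i.1)
        (Set.toFinite _).measurableSet, Measure.infinitePi_map_restrict']
  rw [key, key, ← Measure.infinitePi_map_piCongrLeft (X := fun _ => Bool)
    (μ := fun _ => bernoulliMeasure true false p) e, MeasurableEquiv.map_apply]
  congr 1
  ext b
  have : (N.addMarks fun v => if h : v ∈ N.ball N.root r then b ⟨v, h⟩ else false).Agree r
      (P.addMarks fun v => if h : v ∈ P.ball P.root r then
        (MeasurableEquiv.piCongrLeft (fun _ => Bool) e) b ⟨v, h⟩ else false) := by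
    refine addMarks_agree e h1 h3 h4 fun v => ?_
    simp only [Subtype.coe_prop, dite_true, Subtype.coe_eta]
    exact Equiv.piCongrLeft_apply_apply (fun _ => Bool) e b v
  exact ⟨fun h => h.trans this, fun h => h.trans this.symm⟩

theorem bernoulliLaw_congr (p : unitInterval) {N P : DoublyRootedNetwork Unit} (h : N.Isom P) :
    N.bernoulliLaw p = P.bernoulliLaw p := by
  refine ext_of_generate_finite _ (DoublyRootedClass.measurableSpace_eq (Ξ := Bool))
    DoublyRootedClass.isPiSystem_cyl ?_ (by simp)
  rintro _ ⟨r, M, rfl⟩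
  exact bernoulliLaw_cyl p (h.agree r) M

theorem lintegral_bernoulliLaw (p : unitInterval) (N : DoublyRootedNetwork Unit)
    {g : DoublyRootedClass Bool → ℝ≥0∞} (hg : Measurable g) :
    ∫⁻ z, g z ∂N.bernoulliLaw p = ∫⁻ m, g (N.addMarks m).cls
      ∂Measure.infinitePi fun _ : N.V => bernoulliMeasure true false p :=
  lintegral_map hg N.measurable_addMarks

end DoublyRootedNetwork

namespace DoublyRootedClass

/-- The distribution of `[G, m, o, v]` where the `m u` are independent `Bernoulli(p)` marks. -/
noncomputable def bernoulliLaw (p : unitInterval) :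
    DoublyRootedClass Unit → Measure (DoublyRootedClass Bool) :=
  Quotient.lift (DoublyRootedNetwork.bernoulliLaw p) fun _ _ h =>
    DoublyRootedNetwork.bernoulliLaw_congr p h

instance (p : unitInterval) (z : DoublyRootedClass Unit) :
    IsProbabilityMeasure (z.bernoulliLaw p) := by
  obtain ⟨N, rfl⟩ := exists_rep z
  exact inferInstanceAs (IsProbabilityMeasure (N.bernoulliLaw p))

theorem measurable_bernoulliLaw (p : unitInterval) : Measurable (bernoulliLaw p) := by
  refine Measurable.measure_of_isPiSystem_of_isProbabilityMeasure
    measurableSpace_eq isPiSystem_cyl ?_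
  rintro _ ⟨r, M, rfl⟩
  exact measurable_of_agree _ fun N => ⟨r, fun P h =>
    (DoublyRootedNetwork.bernoulliLaw_cyl p h M).symm⟩

theorem lintegral_bernoulliLaw_swap (p : unitInterval) (z : DoublyRootedClass Unit)
    {g : DoublyRootedClass Bool → ℝ≥0∞} (hg : Measurable g) :
    ∫⁻ y, g y ∂z.swap.bernoulliLaw p = ∫⁻ y, g y.swap ∂z.bernoulliLaw p := by
  obtain ⟨N, rfl⟩ := exists_rep z
  exact (N.swap.lintegral_bernoulliLaw p hg).trans
    (N.lintegral_bernoulliLaw p (hg.comp measurable_swap)).symm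

end DoublyRootedClass

namespace RootedClass

theorem lintegral_bernoulliLaw_cls (p : unitInterval) (N : RootedNetwork Unit)
    {f : RootedClass Bool → ℝ≥0∞} (hf : Measurable f) :
    ∫⁻ x, f x ∂N.cls.bernoulliLaw p = ∫⁻ m, f (N.addMarks m).cls
      ∂Measure.infinitePi fun _ : N.V => bernoulliMeasure true false p :=
  lintegral_map hf N.measurable_addMarks

/-- Marking leaves the countable vertex set unchanged, so this is Tonelli. -/
theorem lintegral_bernoulliLaw_sumSecond (p : unitInterval) (x : RootedClass Unit)
    {g : DoublyRootedClass Bool → ℝ≥0∞} (hg : Measurable g) :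
    ∫⁻ y, sumSecond g y ∂x.bernoulliLaw p =
      sumSecond (fun z => ∫⁻ y, g y ∂z.bernoulliLaw p) x := by
  obtain ⟨N, rfl⟩ := exists_rep x
  have := N.countable
  rw [lintegral_bernoulliLaw_cls p N (measurable_sumSecond hg), sumSecond_cls]
  simp_rw [sumSecond_cls]
  rw [show (∑' v : N.V, ∫⁻ y, g y ∂(N.withSecond v).cls.bernoulliLaw p) =
    ∑' v : N.V, ∫⁻ m, g ((N.withSecond v).addMarks m).cls
      ∂Measure.infinitePi fun _ : N.V => bernoulliMeasure true false p from
    tsum_congr fun v => (N.withSecond v).lintegral_bernoulliLaw p hg]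
  exact lintegral_tsum (β := N.V) 
    (f := fun (v : N.V) (m : N.V → Bool) => g ((N.withSecond v).addMarks m).cls) fun v =>
    (hg.comp (N.withSecond v).measurable_addMarks).aemeasurable

end RootedClass

theorem lintegral_bernoulliMarked (p : unitInterval) (μ : Measure (RootedClass Unit))
    {f : RootedClass Bool → ℝ≥0∞} (hf : Measurable f) :
    ∫⁻ y, f y ∂bernoulliMarked p μ = ∫⁻ x, ∫⁻ y, f y ∂x.bernoulliLaw p ∂μ :=
  Measure.lintegral_bind (bernoulliMarking p).measurable.aemeasurable hf.aemeasurable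

/-- Averaging over the marks turns a transport on marked networks into one on unmarked networks. As
the marks ignore the roots, it commutes with exchanging the roots. -/
theorem isUnimodular_bernoulliMarked (p : unitInterval) {μ : Measure (RootedClass Unit)}
    (hμ : IsUnimodular μ) : IsUnimodular (bernoulliMarked p μ) := by
  intro g hg
  have hg' : Measurable fun z => (g z : ℝ≥0∞) := hg.coe_nnreal_ennreal
  have hs : Measurable fun z : DoublyRootedClass Bool => (g z.swap : ℝ≥0∞) :=
    hg'.comp DoublyRootedClass.measurable_swap
  unfold RootedClass.outMass RootedClass.inMass
  rw [lintegral_bernoulliMarked p μ (RootedClass.measurable_sumSecond hg'),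
    lintegral_bernoulliMarked p μ (RootedClass.measurable_sumSecond hs)]
  simp_rw [RootedClass.lintegral_bernoulliLaw_sumSecond p _ hg',
    RootedClass.lintegral_bernoulliLaw_sumSecond p _ hs]
  rw [hμ.lintegral_sumSecond (g := fun z => ∫⁻ y, (g y : ℝ≥0∞) ∂z.bernoulliLaw p)
    ((Measure.measurable_lintegral hg').comp (DoublyRootedClass.measurable_bernoulliLaw p))]
  simp_rw [DoublyRootedClass.lintegral_bernoulliLaw_swap p _ hg']

/-- A coordinate of a product of Bernoulli measures is independent of any event that does not
depend on that coordinate. -/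
theorem infinitePi_bernoulli_inter {V : Type} [DecidableEq V] (p : unitInterval) (o : V)
    {E : Set (V → Bool)} (hE : MeasurableSet E)
    (ho : ∀ m, Function.update m o true ∈ E ↔ m ∈ E) :
    (Measure.infinitePi fun _ : V => bernoulliMeasure true false p) (E ∩ {m | m o = true}) =
      (unitInterval.toNNReal p : ℝ≥0∞) *
        (Measure.infinitePi fun _ : V => bernoulliMeasure true false p) E := by
  set P := Measure.infinitePi fun _ : V => bernoulliMeasure true false p with hP
  have hind : iIndepFun (fun (v : V) (m : V → Bool) => m v) P :=
    iIndepFun_infinitePi (X := fun (_ : V) (b : Bool) => b) fun _ => measurable_id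
  have hle : ∀ v : V, MeasurableSpace.comap (fun m : V → Bool => m v) inferInstance ≤
      (inferInstance : MeasurableSpace (V → Bool)) := fun v => (measurable_pi_apply v).comap_le
  have hI := indep_iSup_of_disjoint hle hind.iIndep
    (S := {o}ᶜ) (T := {o}) (disjoint_compl_left)
  have hE' : MeasurableSet[⨆ v ∈ ({o}ᶜ : Set V),
      MeasurableSpace.comap (fun m : V → Bool => m v) inferInstance] E := by
    -- Overwriting coordinate `o` is measurable for the σ-algebra of the other coordinates, and `E`
    -- is its own preimage under this map.
    have : E = (fun m => Function.update m o true) ⁻¹' E := Set.ext fun m => (ho m).symm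
    rw [this]
    refine @measurable_pi_lambda _ _ _ (_) _ _ (fun v => ?_) _ hE
    by_cases hv : v = o
    · subst hv
      simp only [Function.update_self]
      exact @measurable_const _ _ _ (_) _
    · simp only [Function.update_of_ne hv]
      exact Measurable.mono (comap_measurable (fun m : V → Bool => m v))
        (le_iSup₂_of_le v hv le_rfl) le_rfl
  have ho' : MeasurableSet[⨆ v ∈ ({o} : Set V),
      MeasurableSpace.comap (fun m : V → Bool => m v) inferInstance] {m | m o = true} := by
    refine (le_iSup₂_of_le (f := fun v (_ : v ∈ ({o} : Set V)) =>
      MeasurableSpace.comap (fun m : V → Bool => m v) inferInstance) o rfl le_rfl) _ ?_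
    exact ⟨{true}, MeasurableSet.singleton _, rfl⟩
  rw [(Indep_iff _ _ _).mp hI _ _ hE' ho', mul_comm]
  congr 1
  have : {m : V → Bool | m o = true} = (fun m => m o) ⁻¹' {true} := rfl
  rw [this, ← Measure.map_apply (measurable_pi_apply o) (MeasurableSet.singleton _), hP,
    Measure.infinitePi_map_eval]
  rw [bernoulliMeasure_apply p (MeasurableSet.singleton _)]
  simp
-- A positive symmetric weight
namespace RootedClass

variable {Ξ : Type}

/-- The number of vertices at distance `k` from the root. -/
noncomputable def sphereCount (k : ℕ) : RootedClass Ξ → ℝ≥0∞ :=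
  sumSecond fun z => if z.rootDist = k then 1 else 0

theorem measurable_sphereCount [Countable Ξ] (k : ℕ) : Measurable (sphereCount (Ξ := Ξ) k) :=
  measurable_sumSecond (Measurable.ite
    (DoublyRootedClass.measurable_rootDist (MeasurableSet.singleton k)) measurable_const
    measurable_const)

theorem sphereCount_ne_top (k : ℕ) (x : RootedClass Ξ) : sphereCount k x ≠ ∞ := by
  obtain ⟨N, rfl⟩ := exists_rep x
  have h : ∀ v : N.V, (N.withSecond v).cls.rootDist = N.dist N.root v := fun _ => rfl
  rw [sphereCount, sumSecond_cls, tsum_eq_sum (s := (N.ball_finite N.root k).toFinset)]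
  · exact ENNReal.sum_ne_top.mpr fun v _ => by split_ifs <;> simp
  · intro v hv
    refine if_neg fun hd => hv ?_
    rw [Set.Finite.mem_toFinset]
    exact le_of_eq hd

end RootedClass

namespace DoublyRootedClass

variable {Ξ : Type}

/-- A positive symmetric weight on pairs of vertices whose sum over one of the vertices is at
most `1`. -/
noncomputable def weight (z : DoublyRootedClass Ξ) : ℝ≥0∞ :=
  2⁻¹ ^ (z.rootDist + 1) *
    (z.atFirst.sphereCount z.rootDist + z.atSecond.sphereCount z.rootDist)⁻¹

theorem measurable_weight [Countable Ξ] : Measurable (weight (Ξ := Ξ)) := by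
  have h : Measurable fun q : ℕ × RootedClass Ξ => q.2.sphereCount q.1 :=
    measurable_from_prod_countable_right fun k => RootedClass.measurable_sphereCount k
  have h2 : Measurable fun k : ℕ => (2⁻¹ : ℝ≥0∞) ^ (k + 1) := measurable_from_top
  exact (h2.comp measurable_rootDist).mul
    ((h.comp (measurable_rootDist.prodMk measurable_atFirst)).add
      (h.comp (measurable_rootDist.prodMk measurable_atSecond))).inv

theorem weight_swap (z : DoublyRootedClass Ξ) : z.swap.weight = z.weight := by
  rw [weight, weight, rootDist_swap, atFirst_swap, atSecond_swap,
    add_comm (z.atSecond.sphereCount _)]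

theorem weight_ne_zero (z : DoublyRootedClass Ξ) : z.weight ≠ 0 := by
  refine mul_ne_zero (pow_ne_zero _ (by simp)) (ENNReal.inv_ne_zero.mpr (ENNReal.add_ne_top.mpr
    ⟨RootedClass.sphereCount_ne_top _ _, RootedClass.sphereCount_ne_top _ _⟩))

/-- Only symmetry needs the sphere count at the second vertex. Without it, the sphere of radius `k`
still contributes at most `2⁻¹ ^ (k + 1)`. -/
theorem sumSecond_weight_le (x : RootedClass Ξ) : RootedClass.sumSecond weight x ≤ 1 := by
  have h : ∀ z : DoublyRootedClass Ξ, z.weight ≤ ∑' k : ℕ,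
      (2⁻¹ ^ (k + 1) * (z.atFirst.sphereCount k)⁻¹) * (if z.rootDist = k then 1 else 0) := by
    intro z
    refine le_trans ?_ (ENNReal.le_tsum z.rootDist)
    rw [if_pos rfl, mul_one, weight]
    gcongr
    exact le_self_add
  calc RootedClass.sumSecond weight x
      ≤ ∑' k : ℕ, (2⁻¹ ^ (k + 1) * (x.sphereCount k)⁻¹) * x.sphereCount k := by
        refine (RootedClass.sumSecond_mono h x).trans ?_
        rw [RootedClass.sumSecond_tsum]
        exact ENNReal.tsum_le_tsum fun k => (RootedClass.sumSecond_atFirst_mul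
          (fun y => 2⁻¹ ^ (k + 1) * (y.sphereCount k)⁻¹) _ x).le
    _ ≤ ∑' k : ℕ, 2⁻¹ ^ (k + 1) := by
        refine ENNReal.tsum_le_tsum fun k => ?_
        rw [mul_assoc]
        exact mul_le_of_le_one_right' (ENNReal.inv_mul_le_one _)
    _ = 1 := by
        rw [ENNReal.tsum_geometric_add_one, ENNReal.one_sub_inv_two, inv_inv,
          ENNReal.inv_mul_cancel (by simp) (by simp)]

end DoublyRootedClass

/-! ### The greedy transport -/

namespace RootedClass

variable {Ξ : Type}

/-- The mass moved when every pair of vertices moves its `w`-share of the supply `q.1` at the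
first vertex and the demand `q.2` at the second vertex. -/
noncomputable def flow (w : DoublyRootedClass Ξ → ℝ≥0∞)
    (q : (RootedClass Ξ → ℝ≥0∞) × (RootedClass Ξ → ℝ≥0∞)) (z : DoublyRootedClass Ξ) : ℝ≥0∞ :=
  q.1 z.atFirst * q.2 z.atSecond * w z

/-- The supply and demand that are left after `n` rounds. -/
noncomputable def residual (w : DoublyRootedClass Ξ → ℝ≥0∞) (s d : RootedClass Ξ → ℝ≥0∞) :
    ℕ → (RootedClass Ξ → ℝ≥0∞) × (RootedClass Ξ → ℝ≥0∞)
  | 0 => (s, d)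
  | n + 1 =>
    (fun x => (residual w s d n).1 x - sumSecond (flow w (residual w s d n)) x,
      fun x => (residual w s d n).2 x - sumSecond (fun z => flow w (residual w s d n) z.swap) x)

theorem measurable_flow {w : DoublyRootedClass Ξ → ℝ≥0∞} (hw : Measurable w)
    {q : (RootedClass Ξ → ℝ≥0∞) × (RootedClass Ξ → ℝ≥0∞)} (h1 : Measurable q.1)
    (h2 : Measurable q.2) : Measurable (flow w q) :=
  ((h1.comp DoublyRootedClass.measurable_atFirst).mul
    (h2.comp DoublyRootedClass.measurable_atSecond)).mul hw

theorem measurable_residual [Countable Ξ] {w : DoublyRootedClass Ξ → ℝ≥0∞} (hw : Measurable w)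
    {s d : RootedClass Ξ → ℝ≥0∞} (hs : Measurable s) (hd : Measurable d) (n : ℕ) :
    Measurable (residual w s d n).1 ∧ Measurable (residual w s d n).2 := by
  induction n with
  | zero => exact ⟨hs, hd⟩
  | succ n ih =>
    have hf := measurable_flow hw ih.1 ih.2
    exact ⟨ih.1.sub (measurable_sumSecond hf),
      ih.2.sub (measurable_sumSecond (hf.comp DoublyRootedClass.measurable_swap))⟩

theorem residual_le_one (w : DoublyRootedClass Ξ → ℝ≥0∞) {s d : RootedClass Ξ → ℝ≥0∞}
    (hs : ∀ x, s x ≤ 1) (hd : ∀ x, d x ≤ 1) (n : ℕ) (x : RootedClass Ξ) :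
    (residual w s d n).1 x ≤ 1 ∧ (residual w s d n).2 x ≤ 1 := by
  induction n with
  | zero => exact ⟨hs x, hd x⟩
  | succ n ih => exact ⟨tsub_le_self.trans ih.1, tsub_le_self.trans ih.2⟩

/-- No vertex sends more than it has left, so the truncated subtraction in `residual` loses nothing.
-/
theorem sumSecond_flow_le {w : DoublyRootedClass Ξ → ℝ≥0∞} (hw : ∀ x, sumSecond w x ≤ 1)
    {q : (RootedClass Ξ → ℝ≥0∞) × (RootedClass Ξ → ℝ≥0∞)} (h2 : ∀ x, q.2 x ≤ 1)
    (x : RootedClass Ξ) : sumSecond (flow w q) x ≤ q.1 x :=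
  calc sumSecond (flow w q) x
      ≤ sumSecond (fun z => q.1 z.atFirst * w z) x := sumSecond_mono (fun z => by
        unfold flow
        gcongr
        exact mul_le_of_le_one_right' (h2 _)) x
    _ = q.1 x * sumSecond w x := sumSecond_atFirst_mul _ _ x
    _ ≤ q.1 x := mul_le_of_le_one_right' (hw x)

theorem sumSecond_flow_swap_le {w : DoublyRootedClass Ξ → ℝ≥0∞}
    (hw : ∀ x, sumSecond (fun z => w z.swap) x ≤ 1)
    {q : (RootedClass Ξ → ℝ≥0∞) × (RootedClass Ξ → ℝ≥0∞)} (h1 : ∀ x, q.1 x ≤ 1)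
    (x : RootedClass Ξ) : sumSecond (fun z => flow w q z.swap) x ≤ q.2 x := by
  -- Exchanging the roots exchanges supply and demand.
  have : (fun z => flow w q z.swap) = flow (fun z => w z.swap) q.swap := by
    funext z
    simp only [flow, DoublyRootedClass.atFirst_swap, DoublyRootedClass.atSecond_swap,
      Prod.fst_swap, Prod.snd_swap, mul_comm (q.1 _)]
  rw [this]
  exact sumSecond_flow_le hw h1 x

/-- Supply and demand can be matched by a transport that leaves no pair `(u, v)` with `w u v ≠ 0`,
a rest of supply at `u` and a rest of demand at `v`. -/
theorem exists_transport [Countable Ξ] {w : DoublyRootedClass Ξ → ℝ≥0∞} (hw : Measurable w)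
    (hw1 : ∀ x, sumSecond w x ≤ 1) (hw2 : ∀ x, sumSecond (fun z => w z.swap) x ≤ 1)
    {s d : RootedClass Ξ → ℝ≥0∞} (hs : Measurable s) (hd : Measurable d)
    (hs1 : ∀ x, s x ≤ 1) (hd1 : ∀ x, d x ≤ 1) :
    ∃ T : DoublyRootedClass Ξ → ℝ≥0∞, Measurable T ∧ (∀ x, sumSecond T x ≤ s x) ∧
      (∀ x, sumSecond (fun z => T z.swap) x ≤ d x) ∧ (∀ z, w z = 0 → T z = 0) ∧
      ∀ z, w z ≠ 0 → sumSecond T z.atFirst = s z.atFirst ∨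
        sumSecond (fun z => T z.swap) z.atSecond = d z.atSecond := by
  set q := residual w s d with hq
  have hq1 : ∀ n x, (q n).1 x ≤ 1 := fun n x => (residual_le_one w hs1 hd1 n x).1
  have hq2 : ∀ n x, (q n).2 x ≤ 1 := fun n x => (residual_le_one w hs1 hd1 n x).2
  have hout : ∀ x n, s x = (q n).1 x + ∑ i ∈ Finset.range n, sumSecond (flow w (q i)) x := by
    intro x n
    induction n with
    | zero => simp [hq, residual]
    | succ n ih =>
      rw [Finset.sum_range_succ_comm, ← add_assoc, ih]
      congr 1
      exact (tsub_add_cancel_of_le (sumSecond_flow_le hw1 (hq2 n) x)).symm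
  have hin : ∀ x n, d x =
      (q n).2 x + ∑ i ∈ Finset.range n, sumSecond (fun z => flow w (q i) z.swap) x := by
    intro x n
    induction n with
    | zero => simp [hq, residual]
    | succ n ih =>
      rw [Finset.sum_range_succ_comm, ← add_assoc, ih]
      congr 1
      exact (tsub_add_cancel_of_le (sumSecond_flow_swap_le hw2 (hq1 n) x)).symm
  have hT1 : ∀ x, sumSecond (fun z => ∑' n, flow w (q n) z) x =
      ∑' n, sumSecond (flow w (q n)) x := fun x => sumSecond_tsum _ x
  have hT2 : ∀ x, sumSecond (fun z => ∑' n, flow w (q n) z.swap) x =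
      ∑' n, sumSecond (fun z => flow w (q n) z.swap) x :=
    fun x => sumSecond_tsum (fun n z => flow w (q n) z.swap) x
  have hle1 : ∀ x, sumSecond (fun z => ∑' n, flow w (q n) z) x ≤ s x := fun x => by
    rw [hT1]
    refine ENNReal.tsum_le_of_sum_range_le fun n => ?_
    rw [hout x n]
    exact le_add_self
  have hle2 : ∀ x, sumSecond (fun z => ∑' n, flow w (q n) z.swap) x ≤ d x := fun x => by
    rw [hT2]
    refine ENNReal.tsum_le_of_sum_range_le fun n => ?_
    rw [hin x n]
    exact le_add_self
  refine ⟨fun z => ∑' n, flow w (q n) z, ?_, hle1, hle2, fun z hz => ?_, fun z hz => ?_⟩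
  · exact Measurable.tsum fun n => measurable_flow hw (measurable_residual hw hs hd n).1
      (measurable_residual hw hs hd n).2
  · simp [flow, hz]
  · by_contra! hne
    have h1 := lt_of_le_of_ne (hle1 z.atFirst) hne.1
    have h2 := lt_of_le_of_ne (hle2 z.atSecond) hne.2
    set a := s z.atFirst - sumSecond (fun z => ∑' n, flow w (q n) z) z.atFirst
    set b := d z.atSecond - sumSecond (fun z => ∑' n, flow w (q n) z.swap) z.atSecond
    have ha : a ≠ 0 := (tsub_pos_of_lt h1).ne'
    have hb : b ≠ 0 := (tsub_pos_of_lt h2).ne'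
    -- Supply `a` and demand `b` survive every round, so every round moves at least this much along
    -- `z`, and the total could not be finite.
    have hlow : ∀ n, a * b * w z ≤ flow w (q n) z := by
      intro n
      unfold flow
      gcongr
      · refine tsub_le_iff_right.mpr ((hout z.atFirst n).le.trans ?_)
        rw [hT1]
        gcongr
        exact ENNReal.sum_le_tsum _
      · refine tsub_le_iff_right.mpr ((hin z.atSecond n).le.trans ?_)
        rw [hT2]
        gcongr
        exact ENNReal.sum_le_tsum _
    have htop : ∑' n, flow w (q n) z = ∞ := by
      refine top_le_iff.mp ((ENNReal.tsum_const_eq_top_of_ne_zero (α := ℕ)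
        (mul_ne_zero (mul_ne_zero ha hb) hz)).ge.trans (ENNReal.tsum_le_tsum hlow))
    have hfin : ∑' n, flow w (q n) z ≤ 1 := by
      obtain ⟨N, v, rfl⟩ := DoublyRootedClass.exists_rep_withSecond z
      exact (ENNReal.le_tsum (f := fun v => ∑' n, flow w (q n) (N.withSecond v).cls) v).trans
        ((hle1 N.cls).trans (hs1 _))
    rw [htop] at hfin
    exact absurd hfin (by simp)

end RootedClass

/-! ### Invariant events and transport over long distances -/

namespace RootedClass

variable {Ξ : Type}

theorem sumSecond_invariant_mul {f : RootedClass Ξ → ℝ≥0∞}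
    (hf : ∀ z : DoublyRootedClass Ξ, f z.atFirst = f z.atSecond)
    (g : DoublyRootedClass Ξ → ℝ≥0∞) (x : RootedClass Ξ) :
    sumSecond (fun z => g z * f z.atSecond) x = f x * sumSecond g x := by
  simp_rw [← sumSecond_atFirst_mul, hf, mul_comm]

/-- The number of vertices `v` such that `[G, v]` is in `B`. -/
noncomputable def vertexCount (B : Set (RootedClass Ξ)) : RootedClass Ξ → ℝ≥0∞ :=
  sumSecond fun z => B.indicator 1 z.atSecond

theorem measurable_vertexCount [Countable Ξ] {B : Set (RootedClass Ξ)} (hB : MeasurableSet B) :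
    Measurable (vertexCount B) :=
  measurable_sumSecond ((measurable_one.indicator hB).comp DoublyRootedClass.measurable_atSecond)

theorem vertexCount_atFirst (B : Set (RootedClass Ξ)) (z : DoublyRootedClass Ξ) :
    vertexCount B z.atFirst = vertexCount B z.atSecond := by
  obtain ⟨N, rfl⟩ := DoublyRootedClass.exists_rep z
  rfl

end RootedClass

section MassTransport

open RootedClass

/-- The mass transport principle restricted to an invariant event. -/
theorem IsUnimodular.lintegral_invariant_mul {Ξ : Type} [Countable Ξ]
    {μ : Measure (RootedClass Ξ)} (hμ : IsUnimodular μ) {g : DoublyRootedClass Ξ → ℝ≥0∞}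
    (hg : Measurable g) {f : RootedClass Ξ → ℝ≥0∞} (hf : Measurable f)
    (hinv : ∀ z : DoublyRootedClass Ξ, f z.atFirst = f z.atSecond) :
    ∫⁻ x, f x * sumSecond g x ∂μ = ∫⁻ x, f x * sumSecond (fun z => g z.swap) x ∂μ := by
  rw [← hμ.lintegral_mul_sumSecond hg hf]
  simp_rw [sumSecond_invariant_mul hinv]

/-- In an infinite unimodular network, an equivariant set of vertices is infinite if it is
nonempty. -/
theorem IsUnimodular.ae_vertexCount_eq_top {Ξ : Type} [Countable Ξ] {μ : Measure (RootedClass Ξ)}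
    [IsFiniteMeasure μ] (hμ : IsUnimodular μ) (hinf : ∀ᵐ x ∂μ, x.IsInfinite)
    {B : Set (RootedClass Ξ)} (hB : MeasurableSet B) :
    ∀ᵐ x ∂μ, x ∈ B → vertexCount B x = ∞ := by
  have hc : Measurable fun z : DoublyRootedClass Ξ => B.indicator (1 : RootedClass Ξ → ℝ≥0∞)
      z.atSecond := (measurable_one.indicator hB).comp DoublyRootedClass.measurable_atSecond
  -- The transport spreads mass at most 1 from each vertex evenly over the vertices in `B`. If their
  -- number is finite, each of them receives the same positive mass from infinitely many vertices,
  -- although the expected incoming mass is finite.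
  have hg : Measurable fun z : DoublyRootedClass Ξ =>
      (vertexCount B z.atFirst)⁻¹ * B.indicator 1 z.atSecond :=
    ((measurable_vertexCount hB).comp DoublyRootedClass.measurable_atFirst).inv.mul hc
  have hle : ∫⁻ x, sumSecond (fun z : DoublyRootedClass Ξ =>
      (vertexCount B z.atFirst)⁻¹ * B.indicator 1 z.atSecond) x ∂μ ≤ μ Set.univ := by
    rw [← lintegral_one]
    refine lintegral_mono fun x => ?_
    rw [sumSecond_atFirst_mul (fun y => (vertexCount B y)⁻¹)]
    exact ENNReal.inv_mul_le_one _
  rw [hμ.lintegral_sumSecond hg] at hle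
  filter_upwards [hinf, ae_lt_top (measurable_sumSecond
    (hg.comp DoublyRootedClass.measurable_swap)) (ne_top_of_le_ne_top (measure_ne_top μ _) hle)]
    with x hx hlt hxB
  by_contra hne
  refine hlt.ne ?_
  obtain ⟨N, rfl⟩ := exists_rep x
  have : Infinite N.V := hx
  rw [sumSecond_cls]
  have hv : ∀ v : N.V, ((fun z : DoublyRootedClass Ξ => (vertexCount B z.atFirst)⁻¹ *
      B.indicator (1 : RootedClass Ξ → ℝ≥0∞) z.atSecond) ∘ DoublyRootedClass.swap)
      (N.withSecond v).cls = (vertexCount B N.cls)⁻¹ := fun v => by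
    rw [Function.comp_apply, DoublyRootedClass.atFirst_swap, DoublyRootedClass.atSecond_swap,
      ← vertexCount_atFirst]
    change (vertexCount B N.cls)⁻¹ * B.indicator 1 N.cls = _
    rw [Set.indicator_of_mem hxB, Pi.one_apply, mul_one]
  simp_rw [hv]
  exact ENNReal.tsum_const_eq_top_of_ne_zero (ENNReal.inv_ne_zero.mpr hne)

/-- On an infinite unimodular network there is a doubly stochastic transport that moves all mass
by a distance at least `L`. -/
theorem IsUnimodular.exists_far_transport {Ξ : Type} [Countable Ξ] {μ : Measure (RootedClass Ξ)}
    [IsFiniteMeasure μ] (hμ : IsUnimodular μ) (hinf : ∀ᵐ x ∂μ, x.IsInfinite) (L : ℕ) :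
    ∃ k : DoublyRootedClass Ξ → ℝ≥0∞, Measurable k ∧ (∀ x, sumSecond k x ≤ 1) ∧
      (∀ x, sumSecond (fun z => k z.swap) x ≤ 1) ∧ (∀ z, z.rootDist < L → k z = 0) ∧
      ∀ᵐ x ∂μ, sumSecond k x = 1 := by
  let w : DoublyRootedClass Ξ → ℝ≥0∞ := fun z => if z.rootDist < L then 0 else z.weight
  have hw : Measurable w := Measurable.ite
    (DoublyRootedClass.measurable_rootDist (MeasurableSet.of_discrete (s := Set.Iio L)))
    measurable_const DoublyRootedClass.measurable_weight
  have hww : ∀ z, w z ≤ z.weight := fun z => by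
    change (if _ then _ else _) ≤ _
    split_ifs <;> simp
  have hw1 : ∀ x, sumSecond w x ≤ 1 := fun x =>
    (sumSecond_mono hww x).trans (DoublyRootedClass.sumSecond_weight_le x)
  have hw2 : ∀ x, sumSecond (fun z => w z.swap) x ≤ 1 := fun x =>
    (sumSecond_mono (fun z => (hww _).trans z.weight_swap.le) x).trans
      (DoublyRootedClass.sumSecond_weight_le x)
  obtain ⟨T, hT, hT1, hT2, hT0, hTw⟩ := exists_transport hw hw1 hw2
    (s := fun _ => 1) (d := fun _ => 1) measurable_const measurable_const
    (fun _ => le_rfl) (fun _ => le_rfl)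
  refine ⟨T, hT, hT1, hT2, fun z hz => hT0 z (if_pos hz), ?_⟩
  have hTs : Measurable (sumSecond fun z => T z.swap) :=
    measurable_sumSecond (hT.comp DoublyRootedClass.measurable_swap)
  set B : Set (RootedClass Ξ) := {x | sumSecond (fun z => T z.swap) x ≠ 1}
  have hB : MeasurableSet B := (hTs (MeasurableSet.singleton 1)).compl
  -- If infinitely many vertices have unmet demand, one lies outside the finite ball of radius `L`;
  -- then `hTw` forces the root to have used its supply.
  have hfull : ∀ x, vertexCount B x = ∞ → sumSecond T x = 1 := by
    intro x hx
    by_contra hne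
    obtain ⟨N, rfl⟩ := exists_rep x
    have hv : ∀ v : N.V, v ∉ (N.ball_finite N.root L).toFinset →
        B.indicator (1 : RootedClass Ξ → ℝ≥0∞) (N.withSecond v).cls.atSecond = 0 := by
      intro v hv
      rw [Set.Finite.mem_toFinset] at hv
      have hd : ¬ (N.withSecond v).cls.rootDist < L := fun h => hv (le_of_lt h)
      refine Set.indicator_of_notMem (fun hvB => ?_) _
      refine (hTw (N.withSecond v).cls ?_).elim hne hvB
      rw [show w _ = _ from if_neg hd]
      exact DoublyRootedClass.weight_ne_zero _
    rw [vertexCount, sumSecond_cls, tsum_eq_sum hv] at hx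
    refine ENNReal.sum_ne_top.mpr (fun v _ => ?_) hx
    rw [Set.indicator_apply]
    split_ifs <;> simp
  -- On the complementary invariant event the root is almost surely outside `B` and so receives mass
  -- 1. Mass transport on this event gives the outgoing mass the same integral, and it is at most 1.
  let f : RootedClass Ξ → ℝ≥0∞ := {x | vertexCount B x = ∞}ᶜ.indicator 1
  have hf : Measurable f := measurable_one.indicator
    ((measurable_vertexCount hB) (MeasurableSet.singleton ∞)).compl
  have hfi : ∀ z : DoublyRootedClass Ξ, f z.atFirst = f z.atSecond := fun z => by
    simp only [f, Set.indicator_apply, Set.mem_compl_iff, Set.mem_ofPred_eq,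
      vertexCount_atFirst B z, Pi.one_apply]
  have hfle : ∀ x, f x ≤ 1 := fun x => Set.indicator_le_self' (fun _ _ => zero_le) x
  have hin : ∫⁻ x, f x ∂μ ≤ ∫⁻ x, f x * sumSecond T x ∂μ := by
    rw [hμ.lintegral_invariant_mul hT hf hfi]
    refine lintegral_mono_ae ?_
    filter_upwards [hμ.ae_vertexCount_eq_top hinf hB] with x hx
    by_cases hxB : x ∈ B
    · have : f x = 0 := Set.indicator_of_notMem
        (s := {x | vertexCount B x = ∞}ᶜ) (fun h => h (hx hxB)) _
      rw [this]
      exact zero_le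
    · rw [not_not.mp hxB, mul_one]
  have hfin : ∫⁻ x, f x * sumSecond T x ∂μ ≠ ∞ := by
    refine ne_top_of_le_ne_top (measure_ne_top μ Set.univ) ?_
    rw [← lintegral_one]
    exact lintegral_mono fun x => mul_le_one' (hfle x) (hT1 x)
  have hae := ae_eq_of_ae_le_of_lintegral_le
    (ae_of_all μ fun x => mul_le_of_le_one_right' (a := f x) (hT1 x)) hfin hf.aemeasurable hin
  filter_upwards [hae] with x hx
  by_cases hQ : vertexCount B x = ∞
  · exact hfull x hQ
  · have : f x = 1 := Set.indicator_of_mem (s := {x | vertexCount B x = ∞}ᶜ) hQ _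
    rwa [this, one_mul] at hx

end MassTransport

/-! ### Local events and the mark of the root -/

namespace RootedClass

/-- Events that depend on the ball of radius `r` around the root only. -/
def IsLocal {Ξ : Type} (r : ℕ) (S : Set (RootedClass Ξ)) : Prop :=
  ∀ M N : RootedNetwork Ξ, M.Agree r N → M.cls ∈ S → N.cls ∈ S

theorem isSetAlgebra_isLocal (Ξ : Type) :
    IsSetAlgebra {S : Set (RootedClass Ξ) | ∃ r, IsLocal r S} where
  empty_mem := ⟨0, fun _ _ _ h => h⟩
  compl_mem := by
    rintro S ⟨r, hr⟩
    exact ⟨r, fun M N h hM hN => hM (hr N M h.symm hN)⟩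
  union_mem := by
    rintro S S' ⟨r, hr⟩ ⟨r', hr'⟩
    exact ⟨max r r', fun M N h hM => hM.imp (hr M N (h.mono (le_max_left _ _)))
      (hr' M N (h.mono (le_max_right _ _)))⟩

theorem measurableSpace_eq_generateFrom_isLocal (Ξ : Type) [Countable Ξ] :
    instMeasurableSpace (Ξ := Ξ) =
      MeasurableSpace.generateFrom {S : Set (RootedClass Ξ) | ∃ r, IsLocal r S} := by
  refine le_antisymm ?_ (MeasurableSpace.generateFrom_le fun S hS => ?_)
  · rw [measurableSpace_eq]
    refine MeasurableSpace.generateFrom_mono ?_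
    rintro _ ⟨r, M, rfl⟩
    exact ⟨r, fun N P h hN => cls_mem_cyl.mpr ((cls_mem_cyl.mp hN).trans h)⟩
  · obtain ⟨r, hr⟩ := hS
    exact measurableSet_of_agree r S hr

/-- Local events form an algebra that generates the Borel σ-algebra, hence are dense in measure. -/
theorem exists_isLocal_symmDiff_lt {Ξ : Type} [Countable Ξ] (μ : Measure (RootedClass Ξ))
    [IsFiniteMeasure μ] {A : Set (RootedClass Ξ)} (hA : MeasurableSet A) {ε : ℝ≥0} (hε : 0 < ε) :
    ∃ r S, IsLocal r S ∧ MeasurableSet S ∧ μ (symmDiff A S) < ε := by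
  obtain ⟨S, ⟨r, hr⟩, hS⟩ := (Measure.MeasureDense.of_generateFrom_isSetAlgebra_finite μ
    (isSetAlgebra_isLocal Ξ) (measurableSpace_eq_generateFrom_isLocal Ξ)).approx A hA
    (measure_ne_top μ A) ε hε
  exact ⟨r, S, hr, measurableSet_of_agree r S hr, by rwa [ENNReal.ofReal_coe_nnreal] at hS⟩

/-- The event that the root is marked. -/
def rootMarked : Set (RootedClass Bool) :=
  {x | Quotient.lift (fun N : RootedNetwork Bool => N.mark N.root)
    (by
      rintro M N ⟨e, -, h2, h3⟩
      rw [← h3, h2]) x = true}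

theorem measurableSet_rootMarked : MeasurableSet rootMarked := by
  refine measurableSet_of_agree 0 _ fun M N h hM => ?_
  obtain ⟨e, -, h2, h3⟩ := h
  have := h2 ⟨M.root, M.root_mem_ball _ 0⟩
  rw [(h3 ⟨M.root, M.root_mem_ball _ 0⟩).mp rfl] at this
  exact this.trans hM

theorem bernoulliLaw_cls_apply (p : unitInterval) (N : RootedNetwork Unit)
    {S : Set (RootedClass Bool)} (hS : MeasurableSet S) :
    N.cls.bernoulliLaw p S = (Measure.infinitePi fun _ : N.V => bernoulliMeasure true false p)
      {m | (N.addMarks m).cls ∈ S} :=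
  Measure.map_apply N.measurable_addMarks hS

/-- Forcing the mark changes nothing when the root is already marked, and the event after forcing
ignores the root's mark, hence is independent of it. -/
theorem bernoulliLaw_inter_rootMarked (p : unitInterval) (x : RootedClass Unit)
    {S : Set (RootedClass Bool)} (hS : MeasurableSet S) :
    x.bernoulliLaw p (S ∩ rootMarked) =
      (unitInterval.toNNReal p : ℝ≥0∞) * x.bernoulliLaw p (forceRoot ⁻¹' S) := by
  classical
  obtain ⟨N, rfl⟩ := exists_rep x
  rw [bernoulliLaw_cls_apply p N (hS.inter measurableSet_rootMarked),
    bernoulliLaw_cls_apply p N (measurable_forceRoot hS)]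
  have hforce : ∀ m : N.V → Bool,
      (N.addMarks m).forceRoot = N.addMarks (Function.update m N.root true) := by
    intro m
    have : (fun v => if v = N.root then true else m v) = Function.update m N.root true := by
      funext v
      rw [Function.update_apply]
    rw [← this]
    unfold RootedNetwork.forceRoot RootedNetwork.addMarks
    congr
  have hE : {m : N.V → Bool | (N.addMarks m).cls ∈ forceRoot ⁻¹' S} =
      {m | (N.addMarks (Function.update m N.root true)).cls ∈ S} := by
    ext m
    change (N.addMarks m).forceRoot.cls ∈ S ↔ _
    rw [hforce]
    rfl
  have hE' : MeasurableSet {m : N.V → Bool | (N.addMarks m).cls ∈ forceRoot ⁻¹' S} :=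
    N.measurable_addMarks (measurable_forceRoot hS)
  rw [← infinitePi_bernoulli_inter p N.root hE']
  · congr 1
    rw [hE]
    ext m
    change ((N.addMarks m).cls ∈ S ∧ m N.root = true) ↔
      ((N.addMarks (Function.update m N.root true)).cls ∈ S ∧ m N.root = true)
    refine and_congr_left fun h => ?_
    rw [← h, Function.update_eq_self]
  · intro m
    rw [hE]
    change (N.addMarks _).cls ∈ S ↔ (N.addMarks _).cls ∈ S
    rw [Function.update_idem]

end RootedClass

namespace DoublyRootedNetwork

/-- Forget the marks. -/
def forget (N : DoublyRootedNetwork Bool) : DoublyRootedNetwork Unit :=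
  { N with mark := fun _ => () }

end DoublyRootedNetwork

namespace DoublyRootedClass

/-- Forget the marks. -/
def forget : DoublyRootedClass Bool → DoublyRootedClass Unit :=
  Quotient.lift (fun N => N.forget.cls) <| by
    rintro M N ⟨e, h1, -, h3, h4⟩
    exact Quotient.sound ⟨e, h1, fun _ => rfl, h3, h4⟩

theorem measurable_forget : Measurable forget := by
  refine Continuous.measurable (continuous_generateFrom_iff.mpr ?_)
  rintro _ ⟨r, P, rfl⟩
  refine isOpen_of_agree _ fun M hM => ⟨r, fun N h => ?_⟩
  obtain ⟨e, h1, -, h3, h4⟩ := h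
  exact cls_mem_cyl.mpr ((cls_mem_cyl.mp (show M.forget.cls ∈ _ from hM)).trans
    ⟨e, h1, fun _ => rfl, h3, h4⟩)

theorem lintegral_bernoulliLaw_mul_forget (p : unitInterval) (z : DoublyRootedClass Unit)
    (k : DoublyRootedClass Unit → ℝ≥0∞) (hk : Measurable k)
    {f : DoublyRootedClass Bool → ℝ≥0∞} (hf : Measurable f) :
    ∫⁻ y, f y * k y.forget ∂z.bernoulliLaw p = (∫⁻ y, f y ∂z.bernoulliLaw p) * k z := by
  obtain ⟨N, rfl⟩ := exists_rep z
  have h1 := N.lintegral_bernoulliLaw p (hf.mul (hk.comp measurable_forget))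
  have h2 := N.lintegral_bernoulliLaw p hf
  refine h1.trans (Eq.trans ?_ (congrArg (· * k N.cls) h2.symm))
  exact lintegral_mul_const (k N.cls) (hf.comp N.measurable_addMarks)

/-- Tested at the second root, `S` reads only marks within distance `r` of it, and the mark of the
first root is not among them. -/
theorem lintegral_bernoulliLaw_far (p : unitInterval) (z : DoublyRootedClass Unit) {r : ℕ}
    {S : Set (RootedClass Bool)} (hS : MeasurableSet S) (hr : RootedClass.IsLocal r S)
    (hz : r < z.rootDist) :
    ∫⁻ y, S.indicator 1 y.atSecond * RootedClass.rootMarked.indicator 1 y.atFirst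
      ∂z.bernoulliLaw p = (unitInterval.toNNReal p : ℝ≥0∞) *
        ∫⁻ y, S.indicator 1 y.atSecond ∂z.bernoulliLaw p := by
  classical
  obtain ⟨N, rfl⟩ := exists_rep z
  have m1 : Measurable fun y : DoublyRootedClass Bool =>
      S.indicator (1 : RootedClass Bool → ℝ≥0∞) y.atSecond :=
    (measurable_one.indicator hS).comp measurable_atSecond
  have m2 : Measurable fun y : DoublyRootedClass Bool =>
      RootedClass.rootMarked.indicator (1 : RootedClass Bool → ℝ≥0∞) y.atFirst :=
    (measurable_one.indicator RootedClass.measurableSet_rootMarked).comp measurable_atFirst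
  set E : Set (N.V → Bool) := {m | (N.addMarks m).atSecond.cls ∈ S}
  have hE : MeasurableSet E := N.measurable_addMarks (measurable_atSecond hS)
  have hO : MeasurableSet {m : N.V → Bool | m N.root = true} :=
    (measurable_pi_apply N.root : Measurable fun m : N.V → Bool => m N.root)
      (MeasurableSet.singleton true)
  have h1 := N.lintegral_bernoulliLaw p (m1.mul m2)
  have h2 := N.lintegral_bernoulliLaw p m1
  refine h1.trans (Eq.trans ?_
    (congrArg ((unitInterval.toNNReal p : ℝ≥0∞) * ·) h2.symm))
  have e1 : ∀ m : N.V → Bool, S.indicator (1 : RootedClass Bool → ℝ≥0∞)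
      (N.addMarks m).cls.atSecond = E.indicator 1 m := fun m => rfl
  have e2 : ∀ m : N.V → Bool, S.indicator (1 : RootedClass Bool → ℝ≥0∞)
      (N.addMarks m).cls.atSecond * RootedClass.rootMarked.indicator 1 (N.addMarks m).cls.atFirst =
      (E ∩ {m | m N.root = true}).indicator 1 m := fun m => by
    rw [Set.inter_indicator_one]
    rfl
  refine (lintegral_congr e2).trans (Eq.trans ?_
    (congrArg ((unitInterval.toNNReal p : ℝ≥0∞) * ·) (lintegral_congr e1).symm))
  rw [lintegral_indicator_one (hE.inter hO), lintegral_indicator_one hE]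
  refine infinitePi_bernoulli_inter p N.root hE fun m => ?_
  have hup : ∀ v : N.V, N.dist N.root₂ v ≤ r → m v = Function.update m N.root true v := by
    intro v hv
    rw [Function.update_of_ne]
    rintro rfl
    rw [N.dist_comm] at hv
    exact absurd hz (not_lt.mpr hv)
  have hA : (N.addMarks (Function.update m N.root true)).atSecond.Agree r
      (N.addMarks m).atSecond := by
    exact ⟨Equiv.refl _, fun _ _ => rfl, fun v => hup v.1 v.2, fun _ => Iff.rfl⟩
  exact ⟨fun h => hr _ _ hA h, fun h => hr _ _ hA.symm h⟩

end DoublyRootedClass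

instance (p : unitInterval) (μ : Measure (RootedClass Unit)) [IsProbabilityMeasure μ] :
    IsProbabilityMeasure (bernoulliMarked p μ) :=
  inferInstanceAs (IsProbabilityMeasure (μ.bind (bernoulliMarking p)))

/-! ### Independence of the root's mark from invariant events -/

section ExtraHead

open RootedClass

variable {μ : Measure (RootedClass Unit)} [IsProbabilityMeasure μ]

theorem bernoulliMarked_inter_rootMarked (p : unitInterval) (μ : Measure (RootedClass Unit))
    {S : Set (RootedClass Bool)} (hS : MeasurableSet S) :
    bernoulliMarked p μ (S ∩ rootMarked) = (unitInterval.toNNReal p : ℝ≥0∞) *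
      (bernoulliMarked p μ).map forceRoot S := by
  rw [Measure.map_apply measurable_forceRoot hS, bernoulliMarked,
    Measure.bind_apply (hS.inter measurableSet_rootMarked)
      (bernoulliMarking p).measurable.aemeasurable,
    Measure.bind_apply (measurable_forceRoot hS) (bernoulliMarking p).measurable.aemeasurable,
    ← lintegral_const_mul _ ((bernoulliMarking p).measurable_coe (measurable_forceRoot hS))]
  exact lintegral_congr fun x => bernoulliLaw_inter_rootMarked p x hS

/-- An upper bound suffices, since the complement of `A` is invariant as well. -/
theorem bernoulliMarked_inter_rootMarked_le (hμ : IsUnimodular μ)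
    (hinf : ∀ᵐ x ∂μ, x.IsInfinite) (p : unitInterval) {A : Set (RootedClass Bool)}
    (hA : MeasurableSet A) (hinv : ∀ z : DoublyRootedClass Bool, z.atFirst ∈ A ↔ z.atSecond ∈ A) :
    bernoulliMarked p μ (A ∩ rootMarked) ≤
      (unitInterval.toNNReal p : ℝ≥0∞) * bernoulliMarked p μ A := by
  set ν := bernoulliMarked p μ with hν_def
  have hν : IsUnimodular ν := isUnimodular_bernoulliMarked p hμ
  have hp1 : (unitInterval.toNNReal p : ℝ≥0∞) ≤ 1 := by
    exact_mod_cast (show unitInterval.toNNReal p ≤ 1 from p.2.2)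
  refine ENNReal.le_of_forall_pos_le_add fun ε hε _ => ?_
  -- The error is paid twice: when `A` is replaced by `S` at the landing vertex, and when `ν S` is
  -- compared with `ν A`.
  obtain ⟨r, S, hr, hS, hAS⟩ := exists_isLocal_symmDiff_lt ν hA (half_pos hε)
  -- Distance `r + 1` puts the starting vertex outside the ball of radius `r` around the landing
  -- vertex.
  obtain ⟨k, hk, hk1, hk2, hk0, hkae⟩ := hμ.exists_far_transport hinf (r + 1)
  have hkf : Measurable fun z : DoublyRootedClass Bool => k z.forget :=
    hk.comp DoublyRootedClass.measurable_forget
  have mfst : ∀ {B : Set (RootedClass Bool)}, MeasurableSet B →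
      Measurable fun z : DoublyRootedClass Bool =>
        B.indicator (1 : RootedClass Bool → ℝ≥0∞) z.atFirst := fun hB =>
    (measurable_one.indicator hB).comp DoublyRootedClass.measurable_atFirst
  have msnd : ∀ {B : Set (RootedClass Bool)}, MeasurableSet B →
      Measurable fun z : DoublyRootedClass Bool =>
        B.indicator (1 : RootedClass Bool → ℝ≥0∞) z.atSecond := fun hB =>
    (measurable_one.indicator hB).comp DoublyRootedClass.measurable_atSecond
  have m1 : Measurable fun z : DoublyRootedClass Bool => S.indicator (1 : RootedClass Bool → ℝ≥0∞)
      z.atSecond * rootMarked.indicator 1 z.atFirst := (msnd hS).mul (mfst measurableSet_rootMarked)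
  have m1k : Measurable fun z : DoublyRootedClass Bool => S.indicator (1 : RootedClass Bool → ℝ≥0∞)
      z.atSecond * rootMarked.indicator 1 z.atFirst * k z.forget := m1.mul hkf
  have mSk : Measurable fun z : DoublyRootedClass Bool =>
      k z.forget * S.indicator (1 : RootedClass Bool → ℝ≥0∞) z.atSecond := hkf.mul (msnd hS)
  have hout : ∀ y : RootedClass Bool, sumSecond (fun z => k z.forget) y ≤ 1 := by
    intro y
    obtain ⟨N, rfl⟩ := exists_rep y
    exact hk1 (RootedNetwork.cls { N with mark := fun _ => () })
  have hin : ∀ y : RootedClass Bool, sumSecond (fun z => k z.swap.forget) y ≤ 1 := by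
    intro y
    obtain ⟨N, rfl⟩ := exists_rep y
    exact hk2 (RootedNetwork.cls { N with mark := fun _ => () })
  have hone : ∀ᵐ y ∂ν, sumSecond (fun z => k z.forget) y = 1 := by
    refine ae_eq_of_ae_le_of_lintegral_le (ae_of_all ν hout) ?_ aemeasurable_const ?_
    · refine ne_top_of_le_ne_top (measure_ne_top ν Set.univ) ?_
      rw [← lintegral_one]
      exact lintegral_mono hout
    · rw [lintegral_bernoulliMarked p μ (measurable_sumSecond hkf)]
      simp_rw [lintegral_bernoulliLaw_sumSecond p _ hkf]
      have : ∀ z : DoublyRootedClass Unit, ∫⁻ y, k y.forget ∂z.bernoulliLaw p = k z := fun z => by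
        have := DoublyRootedClass.lintegral_bernoulliLaw_mul_forget p z k hk
          (f := fun _ => 1) measurable_const
        simpa using this
      simp_rw [this]
      rw [lintegral_congr_ae hkae]
      simp
  have hsend : ∀ {B : Set (RootedClass Bool)}, MeasurableSet B →
      ∫⁻ y, sumSecond (fun z => k z.forget * B.indicator 1 z.atSecond) y ∂ν ≤ ν B := by
    intro B hB
    rw [hν.lintegral_mul_sumSecond hkf (measurable_one.indicator hB), ← lintegral_indicator_one hB]
    exact lintegral_mono fun y => mul_le_of_le_one_right' (hin y)
  have hloc : ∫⁻ y, sumSecond (fun z => S.indicator 1 z.atSecond *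
      rootMarked.indicator 1 z.atFirst * k z.forget) y ∂ν ≤ (unitInterval.toNNReal p : ℝ≥0∞) * ν S := by
    have key : ∀ x : RootedClass Unit,
        ∫⁻ y, sumSecond (fun z => S.indicator 1 z.atSecond * rootMarked.indicator 1 z.atFirst *
          k z.forget) y ∂x.bernoulliLaw p = (unitInterval.toNNReal p : ℝ≥0∞) *
        ∫⁻ y, sumSecond (fun z => k z.forget * S.indicator 1 z.atSecond) y ∂x.bernoulliLaw p := by
      intro x
      rw [lintegral_bernoulliLaw_sumSecond p x mSk,
        lintegral_bernoulliLaw_sumSecond p x m1k, ← sumSecond_const_mul]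
      congr 1
      funext z
      simp_rw [mul_comm (k _)]
      rw [DoublyRootedClass.lintegral_bernoulliLaw_mul_forget p z k hk (msnd hS),
        DoublyRootedClass.lintegral_bernoulliLaw_mul_forget p z k hk m1]
      by_cases hz : z.rootDist < r + 1
      · rw [hk0 z hz, mul_zero, mul_zero, mul_zero]
      · rw [← mul_assoc]
        congr 1
        exact DoublyRootedClass.lintegral_bernoulliLaw_far p z hS hr (by omega)
    calc _ = (unitInterval.toNNReal p : ℝ≥0∞) *
          ∫⁻ y, sumSecond (fun z => k z.forget * S.indicator 1 z.atSecond) y ∂ν := by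
          rw [hν_def, lintegral_bernoulliMarked p μ (measurable_sumSecond m1k),
            lintegral_bernoulliMarked p μ (measurable_sumSecond mSk),
            ← lintegral_const_mul'' _ ?_]
          · exact lintegral_congr key
          · exact ((Measure.measurable_lintegral (measurable_sumSecond
              mSk)).comp (bernoulliMarking p).measurable).aemeasurable
      _ ≤ _ := by gcongr; exact hsend hS
  have hsplit : ν (A ∩ rootMarked) ≤ ∫⁻ y, sumSecond (fun z => S.indicator 1 z.atSecond *
      rootMarked.indicator 1 z.atFirst * k z.forget + k z.forget *
        (symmDiff A S).indicator 1 z.atSecond) y ∂ν := by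
    rw [← lintegral_indicator_one (hA.inter measurableSet_rootMarked)]
    refine lintegral_mono_ae ?_
    filter_upwards [hone] with y hy
    -- The outgoing mass 1 is inserted as a factor. By invariance `A` holds at the landing vertex,
    -- where either `S` holds too or the symmetric difference does.
    rw [← mul_one ((A ∩ rootMarked).indicator 1 y), ← hy, ← sumSecond_atFirst_mul]
    refine sumSecond_mono (fun z => ?_) y
    have hz := hinv z
    by_cases h1 : z.atSecond ∈ A <;> by_cases h2 : z.atSecond ∈ S <;>
      by_cases h3 : z.atFirst ∈ rootMarked <;>
      simp [Set.mem_symmDiff, hz, h1, h2, h3]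
  have hSA : ν S ≤ ν A + ν (symmDiff A S) := by
    refine (measure_mono fun y hy => ?_).trans (measure_union_le _ _)
    by_cases h : y ∈ A
    · exact Or.inl h
    · exact Or.inr (Or.inr ⟨hy, h⟩)
  calc ν (A ∩ rootMarked)
      ≤ (unitInterval.toNNReal p : ℝ≥0∞) * ν S + ν (symmDiff A S) := by
        refine hsplit.trans ?_
        simp_rw [sumSecond_add]
        rw [lintegral_add_left (measurable_sumSecond m1k)]
        exact add_le_add hloc (hsend (hA.symmDiff hS))
    _ ≤ (unitInterval.toNNReal p : ℝ≥0∞) * (ν A + ν (symmDiff A S)) + ν (symmDiff A S) := by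
        gcongr
    _ ≤ (unitInterval.toNNReal p : ℝ≥0∞) * ν A + (ν (symmDiff A S) + ν (symmDiff A S)) := by
        rw [mul_add, add_assoc]
        gcongr
        exact mul_le_of_le_one_left' hp1
    _ ≤ (unitInterval.toNNReal p : ℝ≥0∞) * ν A + ε := by
        gcongr
        refine (add_le_add hAS.le hAS.le).trans ?_
        rw [← ENNReal.coe_add, add_halves]

/-- The mark of the root is independent of every invariant event. -/
theorem bernoulliMarked_inter_rootMarked_of_invariant (hμ : IsUnimodular μ)
    (hinf : ∀ᵐ x ∂μ, x.IsInfinite) (p : unitInterval) {A : Set (RootedClass Bool)}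
    (hA : MeasurableSet A) (hinv : ∀ z : DoublyRootedClass Bool, z.atFirst ∈ A ↔ z.atSecond ∈ A) :
    bernoulliMarked p μ (A ∩ rootMarked) =
      (unitInterval.toNNReal p : ℝ≥0∞) * bernoulliMarked p μ A := by
  refine le_antisymm (bernoulliMarked_inter_rootMarked_le hμ hinf p hA hinv) ?_
  -- The bounds for `A` and its complement add up to `p`, the probability of a marked root, so
  -- neither is strict.
  have h1 := bernoulliMarked_inter_rootMarked_le hμ hinf p hA.compl fun z => (hinv z).not
  have h2 := bernoulliMarked_inter_rootMarked p μ MeasurableSet.univ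
  have := Measure.isProbabilityMeasure_map (μ := bernoulliMarked p μ)
    measurable_forceRoot.aemeasurable
  rw [measure_univ, mul_one, Set.univ_inter, ← measure_inter_add_sdiff rootMarked hA,
    Set.inter_comm, Set.sdiff_eq, Set.inter_comm rootMarked Aᶜ] at h2
  have h3 : (unitInterval.toNNReal p : ℝ≥0∞) * bernoulliMarked p μ A +
      (unitInterval.toNNReal p : ℝ≥0∞) * bernoulliMarked p μ Aᶜ = unitInterval.toNNReal p := by
    rw [← mul_add, measure_add_measure_compl hA, measure_univ, mul_one]
  refine ENNReal.le_of_add_le_add_right (a := (unitInterval.toNNReal p : ℝ≥0∞) *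
    bernoulliMarked p μ Aᶜ) (ENNReal.mul_ne_top ENNReal.coe_ne_top (measure_ne_top _ _)) ?_
  exact (h3.trans h2.symm).le.trans (add_le_add_right h1 _)

end ExtraHead

/-! ### The balanced transport -/

section ExtraHead

open RootedClass

variable {μ : Measure (RootedClass Unit)} [IsProbabilityMeasure μ]

/-- On the Bernoulli marking of an infinite unimodular network there is a transport that moves mass
`p` out of every vertex and mass `1` into every marked vertex. -/
theorem exists_balanced_transport (hμ : IsUnimodular μ) (hinf : ∀ᵐ x ∂μ, x.IsInfinite)
    (p : unitInterval) :
    ∃ T : DoublyRootedClass Bool → ℝ≥0∞, Measurable T ∧ (∀ z, T z ≠ ∞) ∧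
      (∀ᵐ y ∂bernoulliMarked p μ, sumSecond T y = unitInterval.toNNReal p) ∧
      ∀ᵐ y ∂bernoulliMarked p μ, sumSecond (fun z => T z.swap) y = rootMarked.indicator 1 y := by
  set ν := bernoulliMarked p μ
  have hν : IsUnimodular ν := isUnimodular_bernoulliMarked p hμ
  have hp1 : (unitInterval.toNNReal p : ℝ≥0∞) ≤ 1 := by
    exact_mod_cast (show unitInterval.toNNReal p ≤ 1 from p.2.2)
  set P : ℝ≥0∞ := (unitInterval.toNNReal p : ℝ≥0∞)
  have hd : Measurable (rootMarked.indicator (1 : RootedClass Bool → ℝ≥0∞)) :=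
    measurable_one.indicator measurableSet_rootMarked
  obtain ⟨T, hT, hT1, hT2, -, hTw⟩ := exists_transport (Ξ := Bool)
    DoublyRootedClass.measurable_weight DoublyRootedClass.sumSecond_weight_le
    (fun x => (sumSecond_mono (fun z => z.weight_swap.le) x).trans
      (DoublyRootedClass.sumSecond_weight_le x))
    (s := fun _ => P) (d := rootMarked.indicator 1) measurable_const hd
    (fun _ => hp1) (fun x => Set.indicator_le_self' (fun _ _ => zero_le) x)
  have hTtop : ∀ z, T z ≠ ∞ := by
    intro z
    obtain ⟨N, v, rfl⟩ := DoublyRootedClass.exists_rep_withSecond z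
    exact ne_top_of_le_ne_top ENNReal.one_ne_top
      ((ENNReal.le_tsum (f := fun v => T (N.withSecond v).cls) v).trans ((hT1 N.cls).trans hp1))
  set B : Set (RootedClass Bool) := {y | sumSecond T y ≠ P}
  have hB : MeasurableSet B := (measurable_sumSecond hT (MeasurableSet.singleton P)).compl
  -- The invariant event that some vertex keeps supply; since the weight never vanishes, all demand
  -- is met on it.
  set A : Set (RootedClass Bool) := {y | vertexCount B y ≠ 0}
  have hA : MeasurableSet A := ((measurable_vertexCount hB) (MeasurableSet.singleton 0)).compl
  have hinv : ∀ z : DoublyRootedClass Bool, z.atFirst ∈ A ↔ z.atSecond ∈ A := fun z => by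
    change vertexCount B z.atFirst ≠ 0 ↔ vertexCount B z.atSecond ≠ 0
    rw [vertexCount_atFirst]
  have hinvf : ∀ z : DoublyRootedClass Bool,
      A.indicator (1 : RootedClass Bool → ℝ≥0∞) z.atFirst = A.indicator 1 z.atSecond := fun z => by
    by_cases h : z.atFirst ∈ A
    · rw [Set.indicator_of_mem h, Set.indicator_of_mem ((hinv z).mp h), Pi.one_apply, Pi.one_apply]
    · rw [Set.indicator_of_notMem h, Set.indicator_of_notMem fun h' => h ((hinv z).mpr h')]
  have hBA : ∀ y, y ∉ A → sumSecond T y = P := by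
    intro y hy
    obtain ⟨N, rfl⟩ := exists_rep y
    have h0 : ∑' v : N.V, B.indicator (1 : RootedClass Bool → ℝ≥0∞)
      (N.withSecond v).cls.atSecond = 0 := not_not.mp hy
    have h1 : B.indicator (1 : RootedClass Bool → ℝ≥0∞) N.cls = 0 :=
      ENNReal.tsum_eq_zero.mp h0 N.root
    by_contra hne
    rw [Set.indicator_of_mem (show N.cls ∈ B from hne)] at h1
    exact one_ne_zero h1
  have hAin : ∀ y, y ∈ A → sumSecond (fun z => T z.swap) y = rootMarked.indicator 1 y := by
    intro y hy
    obtain ⟨N, rfl⟩ := exists_rep y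
    obtain ⟨v, hv⟩ : ∃ v : N.V, (N.withSecond v).cls.atSecond ∈ B := by
      by_contra! hnone
      exact hy (ENNReal.tsum_eq_zero.mpr fun v => Set.indicator_of_notMem (hnone v) _)
    exact (hTw ((N.withSecond v).cls.swap) (DoublyRootedClass.weight_ne_zero _)).resolve_left hv
  have hAm : Measurable (A.indicator (1 : RootedClass Bool → ℝ≥0∞)) := measurable_one.indicator hA
  -- On `A` the incoming mass is the demand. By independence its integral is the largest that
  -- outgoing mass at most `P` allows.
  have hAint : ∫⁻ y, A.indicator 1 y * sumSecond T y ∂ν = P * ν A := by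
    rw [hν.lintegral_invariant_mul hT hAm hinvf,
      ← bernoulliMarked_inter_rootMarked_of_invariant hμ hinf p hA hinv,
      ← lintegral_indicator_one (hA.inter measurableSet_rootMarked)]
    refine lintegral_congr fun y => ?_
    rw [Set.inter_indicator_one, Pi.mul_apply]
    by_cases hy : y ∈ A
    · rw [hAin y hy]
    · rw [Set.indicator_of_notMem hy, zero_mul, zero_mul]
  have hout : ∀ᵐ y ∂ν, sumSecond T y = P := by
    have hae := ae_eq_of_ae_le_of_lintegral_le (μ := ν)
      (f := fun y => A.indicator 1 y * sumSecond T y) (g := fun y => A.indicator 1 y * P)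
      (ae_of_all _ fun y => mul_le_mul_right (hT1 y) _)
      (by rw [hAint]; exact ENNReal.mul_ne_top ENNReal.coe_ne_top (measure_ne_top _ _))
      (hAm.mul_const P).aemeasurable
      (by rw [hAint, lintegral_mul_const _ hAm, lintegral_indicator_one hA, mul_comm])
    filter_upwards [hae] with y hy
    by_cases h : y ∈ A
    · simpa only [Set.indicator_of_mem h, Pi.one_apply, one_mul] using hy
    · exact hBA y h
  refine ⟨T, hT, hTtop, hout, ?_⟩
  -- The incoming mass is at most the demand, and both have mean `P`.
  have hint : ∫⁻ y, sumSecond (fun z => T z.swap) y ∂ν = P := by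
    rw [← hν.lintegral_sumSecond hT, lintegral_congr_ae hout, lintegral_const, measure_univ,
      mul_one]
  refine ae_eq_of_ae_le_of_lintegral_le (ae_of_all _ hT2) (by rw [hint]; exact ENNReal.coe_ne_top)
    hd.aemeasurable ?_
  have h := bernoulliMarked_inter_rootMarked_of_invariant hμ hinf p MeasurableSet.univ
    fun _ => Iff.rfl
  rw [Set.univ_inter, measure_univ, mul_one] at h
  rw [hint, lintegral_indicator_one measurableSet_rootMarked, h]

end ExtraHead

/-! ### The kernel of the extra head scheme -/

theorem mainTheorem8 (μ : Measure (RootedClass Unit)) [IsProbabilityMeasure μ]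
    (hμ : IsUnimodular μ) (hinf : ∀ᵐ x ∂μ, x.IsInfinite)
    (p : unitInterval) (hp : 0 < p) :
    ∃ T : DoublyRootedClass Bool → ℝ≥0,
      IsRootChange T (bernoulliMarked p μ) ((bernoulliMarked p μ).map RootedClass.forceRoot) := by
  obtain ⟨T, hT, hTtop, hout, hin⟩ := exists_balanced_transport hμ hinf p
  have hν := isUnimodular_bernoulliMarked p hμ
  have hp0 : (unitInterval.toNNReal p : ℝ≥0∞) ≠ 0 := by
    exact_mod_cast (show 0 < unitInterval.toNNReal p from hp).ne'
  set P : ℝ≥0∞ := (unitInterval.toNNReal p : ℝ≥0∞) with hP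
  have hPtop : P ≠ ∞ := ENNReal.coe_ne_top
  have hcoe : ∀ z, ((P⁻¹ * T z).toNNReal : ℝ≥0∞) = P⁻¹ * T z := fun z =>
    ENNReal.coe_toNNReal (ENNReal.mul_ne_top (ENNReal.inv_ne_top.mpr hp0) (hTtop z))
  refine ⟨fun z => (P⁻¹ * T z).toNNReal, (hT.const_mul _).ennreal_toNNReal, ?_, fun A hA => ?_⟩
  · filter_upwards [hout] with y hy
    unfold RootedClass.outMass
    simp_rw [hcoe]
    rw [RootedClass.sumSecond_const_mul, hy, ENNReal.inv_mul_cancel hp0 hPtop]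
  · simp_rw [hcoe]
    have hAm : Measurable (A.indicator fun _ => (1 : ℝ≥0∞)) := measurable_const.indicator hA
    -- Mass transport moves the test of `A` to the root, where the incoming mass is `P⁻¹` times the
    -- indicator of a marked root.
    rw [hν.lintegral_mul_sumSecond (hT.const_mul _) hAm]
    have : ∀ᵐ y ∂bernoulliMarked p μ, A.indicator (fun _ => (1 : ℝ≥0∞)) y *
        RootedClass.sumSecond (fun z => P⁻¹ * T z.swap) y =
        P⁻¹ * (A ∩ RootedClass.rootMarked).indicator 1 y := by
      filter_upwards [hin] with y hy
      rw [RootedClass.sumSecond_const_mul P⁻¹ fun z => T z.swap, hy, Set.inter_indicator_one,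
        Pi.mul_apply, mul_left_comm]
      rfl
    have hAR := hA.inter RootedClass.measurableSet_rootMarked
    -- Conditioning on a marked root has the same effect as forcing the mark.
    rw [lintegral_congr_ae this, lintegral_const_mul _ (measurable_one.indicator hAR),
      lintegral_indicator_one hAR, bernoulliMarked_inter_rootMarked p μ hA, ← mul_assoc, ← hP,
      ENNReal.inv_mul_cancel hp0 hPtop, one_mul]
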